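/- Let $d\ge 2$, let $T_d$ be the (infinite) $d$-regular tree and let $S$ be a finite set. An invariant process with values in $S$ is a probability measure on $S^{V(T_d)}$ that is invariant under all automorphisms of $T_d$. A sequence of finite graphs $G_1,G_2,\dots$ has large girth if for every $\varepsilon>0$, for all large $i$, the probability that a uniform random vertex of $G_i$ lies on a cycle of length at most $\lceil 1/\varepsilon\rceil$ is at most $\varepsilon$. For such a sequence of $d$-regular graphs, let $[\{G_i\}]$ be the set of invariant processes $\mu$ (with values in a finite set $S$) for which there are colorings $f_i:V(G_i)\to S$ such that for every $r\in\mathbb N$ the distribution of the rooted colored $r$-neighborhood (up to isomorphism) of a uniform random vertex of $(G_i,f_i)$ converges, as $i\to\infty$, to the distribution of the $\mu$-randomly colored $r$-neighborhood of a root $o$ of $T_d$. An invariant process $\nu$ is called typical if there is a fixed sequence of sizes $n_1,n_2,\dots$, for each of which $d$-regular graphs on $n_i$ vertices exist, such that with probability $1$ one has $\nu\in[\{\mathbb G_{n_i}\}_{i=1}^\infty]$, where the $\mathbb G_{n_i}$ are independent and $\mathbb G_{n_i}$ is a uniform random (simple, labelled) $d$-regular graph on $n_i$ vertices. For a finite set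 $F\subset V(T_d)$ let $h(F)=-\sum_{c\in S^F}p_c\ln p_c$ (with $0\ln 0=0$) be the entropy of the distribution $(p_c)$ of the restriction to $F$ of a $\nu$-random coloring. **Theorem.** If $\nu$ is a typical process on $T_d$ with values in a finite set $S$, then for every edge $\{u,v\}$ and every vertex $w$ of $T_d$, $$\frac d2\,h(\{u,v\})\ \ge\ (d-1)\,h(\{w\}).$$ -/

import Mathlib

open MeasureTheory ProbabilityTheory Filter Topology

noncomputable section

namespace TypicalProcess

/-! ### Invariant processes on a tree -/

/-- `μ` is an invariant process on the graph `T` with values in `S`: a probability measure on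
labellings `V → S` that is invariant under every automorphism of `T`, where `φ` acts by giving
each vertex the label of its inverse image. -/
structure IsInvariantProcess {V S : Type*} [MeasurableSpace S] (T : SimpleGraph V)
    (μ : Measure (V → S)) : Prop where
  isProbabilityMeasure : IsProbabilityMeasure μ
  map_eq : ∀ φ : T ≃g T, μ.map (fun ω : V → S => fun v => ω (φ.symm v)) = μ

/-! ### Colored neighborhoods -/

/-- The vertices at graph distance at most `r` from `v`. -/
def ball {V : Type*} (G : SimpleGraph V) (v : V) (r : ℕ) : Set V :=
  {x | G.edist v x ≤ (r : ℕ∞)}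

/-- The radius-`r` neighborhood of `v` in `G` colored by `f` and the radius-`r` neighborhood of `w`
in `H` colored by `g` are isomorphic as rooted colored graphs. -/
def BallIso {V W S : Type*} (G : SimpleGraph V) (f : V → S) (v : V)
    (H : SimpleGraph W) (g : W → S) (w : W) (r : ℕ) : Prop :=
  ∃ e : G.induce (ball G v r) ≃g H.induce (ball H w r),
    (∀ x : ball G v r, (x : V) = v → (e x : W) = w) ∧ ∀ x : ball G v r, g (e x : W) = f x

/-- The probability that a uniform random vertex of `Fin n` lies in `A`. -/
def vertexProb {n : ℕ} (A : Set (Fin n)) : ℝ := (A.ncard : ℝ) / (n : ℝ)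

/-- A sequence of finite graphs has large girth: for every `ε > 0`, eventually the probability that
a random vertex lies on a cycle of length at most `⌈1 / ε⌉` is at most `ε`. -/
def IsLargeGirth {n : ℕ → ℕ} (G : ∀ i, SimpleGraph (Fin (n i))) : Prop :=
  ∀ ε : ℝ, 0 < ε → ∃ N : ℕ, ∀ i, N ≤ i →
    vertexProb {v | ∃ c : (G i).Walk v v, c.IsCycle ∧ c.length ≤ ⌈1 / ε⌉₊} ≤ ε

/-- The colored graphs `(G i, f i)` converge in the Benjamini-Schramm sense to the process `μ` on
`T`: for every radius `r`, the law of the isomorphism class of the colored `r`-neighborhood of a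
random vertex of `G i` converges to the law of the isomorphism class of the `μ`-randomly colored
`r`-neighborhood of the root of `T`. The limit law is a probability measure carried by the finitely
many classes of colorings `g` of the `r`-neighborhood in `T`, so weak convergence is convergence of
the probabilities of these classes (the other classes then have total mass tending to `0`).
For an invariant process on a regular tree the choice of the root `o` is immaterial. -/
def BSConverges {V S : Type*} [MeasurableSpace S] {n : ℕ → ℕ}
    (G : ∀ i, SimpleGraph (Fin (n i))) (f : ∀ i, Fin (n i) → S)
    (T : SimpleGraph V) (μ : Measure (V → S)) : Prop :=
  ∀ (o : V) (r : ℕ) (g : V → S),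
    Tendsto (fun i => vertexProb {v | BallIso (G i) (f i) v T g o r}) atTop
      (𝓝 (μ.real {ω | BallIso T ω o T g o r}))

/-- `μ ∈ [G]`: the sequence `G` has large girth and the invariant process `μ` is the
Benjamini-Schramm limit of some colorings of the graphs in the sequence. -/
def IsColoringLimit {V S : Type*} [MeasurableSpace S] (T : SimpleGraph V) {n : ℕ → ℕ}
    (G : ∀ i, SimpleGraph (Fin (n i))) (μ : Measure (V → S)) : Prop :=
  IsInvariantProcess T μ ∧ IsLargeGirth G ∧
    ∃ f : ∀ i, Fin (n i) → S, BSConverges G f T μ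

/-! ### Random regular graphs and typical processes -/

/-- The set of `d`-regular (simple, labelled) graphs on `n` vertices. -/
def regularGraphs (d n : ℕ) : Set (SimpleGraph (Fin n)) :=
  open Classical in {G | G.IsRegularOfDegree d}

/-- The law of the uniform random `d`-regular graph on `n` vertices. -/
def randomRegularGraph (d n : ℕ) : Measure (SimpleGraph (Fin n)) :=
  uniformOn (regularGraphs d n)

instance {n : ℕ} : MeasurableSingletonClass (SimpleGraph (Fin n)) where
  measurableSet_singleton G := by
    have h : ({G} : Set (SimpleGraph (Fin n))) =
        ⋂ u, ⋂ v, {H | H.Adj u v ↔ G.Adj u v} := by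
      ext H
      simp [SimpleGraph.ext_iff, funext_iff]
    rw [h]
    refine MeasurableSet.iInter fun u => MeasurableSet.iInter fun v => ?_
    have hm : Measurable fun H : SimpleGraph (Fin n) => H.Adj u v :=
      (SimpleGraph.measurable_iff_adj (Ω := SimpleGraph (Fin n)) (G := id)).1 measurable_id u v
    exact measurableSet_setOfPred.2 (hm.iff measurable_const)

theorem isProbabilityMeasure_randomRegularGraph {d n : ℕ} (h : (regularGraphs d n).Nonempty) :
    IsProbabilityMeasure (randomRegularGraph d n) :=
  isProbabilityMeasure_uniformOn (Set.toFinite _) h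

/-- The law of a sequence of independent uniform random `d`-regular graphs with `n 0, n 1, …`
vertices. -/
def randomRegularSeq (d : ℕ) (n : ℕ → ℕ) (hn : ∀ i, (regularGraphs d (n i)).Nonempty) :
    Measure (∀ i, SimpleGraph (Fin (n i))) :=
  haveI := fun i => isProbabilityMeasure_randomRegularGraph (hn i)
  Measure.infinitePi fun i => randomRegularGraph d (n i)

/-- `μ` is a typical process on the `d`-regular tree `T`: for some fixed sequence `n` of sizes (for
which `d`-regular graphs exist), with probability one `μ ∈ [G]`, where `G` is the sequence of
independent uniform random `d`-regular graphs with `n i` vertices. -/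
def IsTypical {V S : Type*} [MeasurableSpace S] (d : ℕ) (T : SimpleGraph V)
    (μ : Measure (V → S)) : Prop :=
  IsInvariantProcess T μ ∧
    ∃ (n : ℕ → ℕ) (hn : ∀ i, (regularGraphs d (n i)).Nonempty),
      ∀ᵐ G ∂(randomRegularSeq d n hn), IsColoringLimit T G μ

/-! ### Configuration entropy -/

/-- The entropy `-∑ p ln p` of a probability distribution on a finite set. -/
def entropy {A : Type*} [Fintype A] [MeasurableSpace A] (P : Measure A) : ℝ :=
  ∑ a, -(P.real {a} * Real.log (P.real {a}))

/-- The entropy `h(F)` of the distribution that `μ` induces on the colorings of the finite vertex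
set `F`. -/
def configEntropy {V S : Type*} [DecidableEq V] [Fintype S] [MeasurableSpace S]
    (μ : Measure (V → S)) (F : Finset V) : ℝ :=
  entropy (μ.map (fun ω : V → S => fun x : F => ω x))

end TypicalProcess

end

/-!
The theorem is a first moment bound. Write `p` for the law of the colors on an edge, `q` for the law
at a vertex, and `h` for entropy. The expected number of colorings of a random `d`-regular graph on
`n` vertices whose edge statistics are close to `p` is about
`exp (n * (d / 2 * h p - (d - 1) * h q))`. If `ν` is typical, then with probability bounded away
from zero such a coloring exists, so that the exponent cannot be negative.

The expectation is computed in the configuration model: a pairing is a fixed-point-free involution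
`σ` of the `m = n d` half-edges `(x, i)`, and a simple `d`-regular graph comes from exactly
`(d!) ^ n` pairings (`card_filter_pairingGraph_eq`).

* Passing from simple graphs to all pairings costs a polynomial factor
  (`card_pairings_le_card_simplePairings`). At least half of all pairings have at most `16 d ^ 2`
  half-edges on loops or multiple edges, by Markov's inequality; each defect can be repaired by a
  conjugation with a transposition, and there are only `m ^ 2` transpositions to choose from.
* For a fixed coloring `f` of the half-edges, the fraction of the pairings that have given color
  statistics `M` depends only on the color counts of `f`. By averaging over all relabellings of the
  half-edges, it is at most the number of colorings of a single pairing with statistics `M`, which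
  is at most `exp (m / 2 * h (M / m))`, divided by the number of colorings with the given color
  counts, which is `exp (m * h q)` up to a polynomial factor (`factorial_mul_card_filter_le`,
  `card_filter_pairings_pairType_le`).
* Together this gives `exists_le_mul_bethe`: if a fixed fraction of the `d`-regular graphs has
  colorings with statistics in a set `𝓜`, then the exponent of some member of `𝓜` is at least
  `-O(log n / n)`.

On the side of the limit, Benjamini-Schramm convergence at radius `1` shows that the edge statistics
converge to the law of `ν` at a vertex and a random neighbor (`BSConverges.tendsto_dartType`). All
edges at a vertex have the same law since a regular tree has an automorphism that fixes a vertex and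
exchanges two of its neighbors (`exists_iso_of_adj`). Large girth forces the number of vertices to
tend to infinity (`IsLargeGirth.tendsto_card`), so the error terms vanish, and the continuity of
`-x log x` concludes.
-/

namespace TypicalProcess

/-! ### Fixed-point-free involutions -/

section Pairings

variable {A : Type*} [Fintype A] [DecidableEq A]

/-- The perfect matchings of the finite set `A`, encoded as fixed-point-free involutions. -/
def pairings (A : Type*) [Fintype A] [DecidableEq A] : Finset (Equiv.Perm A) :=
  Finset.univ.filter fun σ => ∀ a, σ (σ a) = a ∧ σ a ≠ a

theorem mem_pairings {σ : Equiv.Perm A} :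
    σ ∈ pairings A ↔ ∀ a, σ (σ a) = a ∧ σ a ≠ a := by
  simp [pairings]

theorem conj_mem_pairings {σ : Equiv.Perm A} (hσ : σ ∈ pairings A) (τ : Equiv.Perm A) :
    τ * σ * τ⁻¹ ∈ pairings A := by
  rw [mem_pairings] at *
  intro a
  refine ⟨by simp [(hσ _).1], fun h => (hσ (τ⁻¹ a)).2 (Equiv.Perm.eq_inv_iff_eq.2 h)⟩

/-- If a family of matchings is invariant under the transpositions of a set `B`, then the partner
of a point outside `B` is equally likely to be any element of `B`. -/
theorem card_mul_card_partner_le (Q : Finset (Equiv.Perm A)) (B : Finset A) {a b : A}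
    (ha : a ∉ B) (hb : b ∈ B)
    (hQ : ∀ b' ∈ B, ∀ σ ∈ Q, Equiv.swap b b' * σ * (Equiv.swap b b')⁻¹ ∈ Q) :
    B.card * (Q.filter fun σ => σ a = b).card ≤ Q.card := by
  have hle : ∀ b' ∈ B, (Q.filter fun σ => σ a = b).card ≤ (Q.filter fun σ => σ a = b').card := by
    intro b' hb'
    refine Finset.card_le_card_of_injOn
      (fun σ => Equiv.swap b b' * σ * (Equiv.swap b b')⁻¹) ?_ ?_
    · intro σ hσ
      simp only [Finset.coe_filter, Set.mem_ofPred_eq] at hσ ⊢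
      refine ⟨hQ b' hb' σ hσ.1, ?_⟩
      have h1 : a ≠ b := fun h => ha (h ▸ hb)
      have h2 : a ≠ b' := fun h => ha (h ▸ hb')
      simp [Equiv.swap_apply_of_ne_of_ne h1 h2, hσ.2]
    · intro σ _ τ _ h
      simpa using h
  calc B.card * (Q.filter fun σ => σ a = b).card
      = ∑ b' ∈ B, (Q.filter fun σ => σ a = b).card := by simp
    _ ≤ ∑ b' ∈ B, (Q.filter fun σ => σ a = b').card := Finset.sum_le_sum hle
    _ = (B.biUnion fun b' => Q.filter fun σ => σ a = b').card := by
        rw [Finset.card_biUnion]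
        intro x _ y _ hxy
        refine Finset.disjoint_left.2 fun σ h1 h2 => hxy ?_
        rw [← (Finset.mem_filter.1 h1).2, (Finset.mem_filter.1 h2).2]
    _ ≤ Q.card := Finset.card_le_card (Finset.biUnion_subset.2 fun _ _ => Finset.filter_subset _ _)

theorem card_pairings_filter_one {a b : A} (hab : a ≠ b) :
    (Fintype.card A - 3) * ((pairings A).filter fun σ => σ a = b).card ≤ (pairings A).card := by
  refine le_trans (Nat.mul_le_mul_right _ ?_) (card_mul_card_partner_le (pairings A)
    (Finset.univ.erase a) (a := a) (b := b) (by simp) (by simp [hab.symm])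
    fun b' _ σ hσ => conj_mem_pairings hσ _)
  rw [Finset.card_erase_of_mem (Finset.mem_univ _), Finset.card_univ]
  omega

theorem card_pairings_filter_two {a b a' b' : A} (hab : a ≠ b)
    (h3 : b' ≠ a) (h4 : b' ≠ b) (h5 : b' ≠ a') :
    (Fintype.card A - 3) ^ 2 * ((pairings A).filter fun σ => σ a = b ∧ σ a' = b').card ≤
      (pairings A).card := by
  have key := card_mul_card_partner_le ((pairings A).filter fun σ => σ a = b)
    (Finset.univ \ {a, b, a'}) (a := a') (b := b') (by simp) (by simp [h3, h4, h5]) (by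
      intro c hc σ hσ
      simp only [Finset.mem_sdiff, Finset.mem_univ, true_and, Finset.mem_insert,
        Finset.mem_singleton, not_or] at hc
      simp only [Finset.mem_filter] at hσ ⊢
      refine ⟨conj_mem_pairings hσ.1 _, ?_⟩
      simp [Equiv.swap_apply_of_ne_of_ne h3.symm (Ne.symm hc.1), hσ.2,
        Equiv.swap_apply_of_ne_of_ne h4.symm (Ne.symm hc.2.1)])
  rw [Finset.filter_filter] at key
  have hc : Fintype.card A - 3 ≤ (Finset.univ \ {a, b, a'} : Finset A).card := by
    rw [Finset.card_sdiff_of_subset (Finset.subset_univ _), Finset.card_univ]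
    exact Nat.sub_le_sub_left Finset.card_le_three _
  calc _ = (Fintype.card A - 3) * ((Fintype.card A - 3) *
        ((pairings A).filter fun σ => σ a = b ∧ σ a' = b').card) := by ring
    _ ≤ (Fintype.card A - 3) * ((pairings A).filter fun σ => σ a = b).card :=
        Nat.mul_le_mul_left _ ((Nat.mul_le_mul_right _ hc).trans key)
    _ ≤ _ := card_pairings_filter_one hab

end Pairings

/-! ### Simple pairings -/

section Simple

variable {V : Type*} [Fintype V] [DecidableEq V] {d : ℕ}

/-- The half-edges of a pairing that lie on a loop or on a multiple edge. The half-edges at the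
vertex `x` are the pairs `(x, i)`. -/
def badHalfEdges (σ : Equiv.Perm (V × Fin d)) : Finset (V × Fin d) :=
  Finset.univ.filter fun a => (σ a).1 = a.1 ∨ ∃ a', a' ≠ a ∧ a'.1 = a.1 ∧ (σ a').1 = (σ a).1

theorem mem_badHalfEdges {σ : Equiv.Perm (V × Fin d)} {a : V × Fin d} :
    a ∈ badHalfEdges σ ↔
      (σ a).1 = a.1 ∨ ∃ a', a' ≠ a ∧ a'.1 = a.1 ∧ (σ a').1 = (σ a).1 := by
  simp [badHalfEdges]

/-- The half-edges at the vertex `x`. -/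
def halfEdgesAt {V : Type*} [DecidableEq V] (d : ℕ) (x : V) : Finset (V × Fin d) :=
  Finset.univ.image fun i => (x, i)

theorem mem_halfEdgesAt {V : Type*} [DecidableEq V] {d : ℕ} {x : V}
    {a : V × Fin d} : a ∈ halfEdgesAt d x ↔ a.1 = x := by
  simp only [halfEdgesAt, Finset.mem_image, Finset.mem_univ, true_and]
  exact ⟨by rintro ⟨i, rfl⟩; rfl, by rintro rfl; exact ⟨a.2, rfl⟩⟩

theorem card_halfEdgesAt {V : Type*} [DecidableEq V] {d : ℕ} (x : V) :
    (halfEdgesAt d x).card = d := by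
  rw [halfEdgesAt, Finset.card_image_of_injective _ fun i j h => (Prod.ext_iff.1 h).2]
  simp

/-- A given half-edge is bad in a fraction `O(1 / m)` of the pairings of `m` half-edges. -/
theorem card_filter_mem_badHalfEdges_le (a : V × Fin d) :
    (Fintype.card (V × Fin d) - 3) ^ 2 *
      ((pairings (V × Fin d)).filter fun σ => a ∈ badHalfEdges σ).card ≤
    2 * d ^ 2 * Fintype.card (V × Fin d) * (pairings (V × Fin d)).card := by
  set m := Fintype.card (V × Fin d)
  set X := pairings (V × Fin d)
  have hd : 1 ≤ d := Nat.one_le_of_lt a.2.isLt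
  have hsub : (X.filter fun σ => a ∈ badHalfEdges σ) ⊆
      (((halfEdgesAt d a.1).erase a).biUnion fun b => X.filter fun σ => σ a = b) ∪
      ((halfEdgesAt d a.1).erase a).biUnion fun a' =>
        ((Finset.univ : Finset (V × Fin d)).erase a).biUnion fun b =>
          ((((halfEdgesAt d b.1).erase b).erase a).erase a').biUnion fun b' =>
            X.filter fun σ => σ a = b ∧ σ a' = b' := by
    intro σ hσ
    rw [Finset.mem_filter, mem_badHalfEdges] at hσ
    have hp := mem_pairings.1 hσ.1
    simp only [Finset.mem_union, Finset.mem_biUnion, Finset.mem_erase, mem_halfEdgesAt,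
      Finset.mem_filter, Finset.mem_univ, and_true]
    by_cases hl : (σ a).1 = a.1
    · exact Or.inl ⟨σ a, ⟨(hp a).2, hl⟩, hσ.1, rfl⟩
    · obtain ⟨a', h1, h2, h3⟩ := hσ.2.resolve_left hl
      refine Or.inr ⟨a', ⟨h1, h2⟩, σ a, (hp a).2, σ a', ⟨(hp a').2, ?_, ?_, h3⟩, hσ.1, rfl, rfl⟩
      · rintro h
        exact hl (by rw [← h3, h])
      · exact fun h => h1 (σ.injective h)
  have h1 : (m - 3) * (((halfEdgesAt d a.1).erase a).biUnion
      fun b => X.filter fun σ => σ a = b).card ≤ d * X.card := by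
    calc _ ≤ (m - 3) * ∑ b ∈ (halfEdgesAt d a.1).erase a, (X.filter fun σ => σ a = b).card :=
          Nat.mul_le_mul_left _ Finset.card_biUnion_le
      _ = ∑ b ∈ (halfEdgesAt d a.1).erase a, (m - 3) * (X.filter fun σ => σ a = b).card :=
          Finset.mul_sum _ _ _
      _ ≤ ∑ b ∈ (halfEdgesAt d a.1).erase a, X.card :=
          Finset.sum_le_sum fun b hb => card_pairings_filter_one (Finset.mem_erase.1 hb).1.symm
      _ ≤ d * X.card := by
          rw [Finset.sum_const, smul_eq_mul]
          refine Nat.mul_le_mul_right _ ((Finset.card_erase_le).trans (card_halfEdgesAt _).le)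
  have h2 : (m - 3) ^ 2 * (((halfEdgesAt d a.1).erase a).biUnion fun a' =>
        ((Finset.univ : Finset (V × Fin d)).erase a).biUnion fun b =>
          ((((halfEdgesAt d b.1).erase b).erase a).erase a').biUnion fun b' =>
            X.filter fun σ => σ a = b ∧ σ a' = b').card ≤ d * (m * (d * X.card)) := by
    calc _ ≤ (m - 3) ^ 2 * ∑ a' ∈ (halfEdgesAt d a.1).erase a,
            ∑ b ∈ (Finset.univ : Finset (V × Fin d)).erase a,
              ∑ b' ∈ (((halfEdgesAt d b.1).erase b).erase a).erase a',
                (X.filter fun σ => σ a = b ∧ σ a' = b').card := by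
          refine Nat.mul_le_mul_left _ (Finset.card_biUnion_le.trans
            (Finset.sum_le_sum fun _ _ => Finset.card_biUnion_le.trans
              (Finset.sum_le_sum fun _ _ => Finset.card_biUnion_le)))
      _ = ∑ a' ∈ (halfEdgesAt d a.1).erase a,
            ∑ b ∈ (Finset.univ : Finset (V × Fin d)).erase a,
              ∑ b' ∈ (((halfEdgesAt d b.1).erase b).erase a).erase a',
                (m - 3) ^ 2 * (X.filter fun σ => σ a = b ∧ σ a' = b').card := by
          simp only [Finset.mul_sum]
      _ ≤ ∑ a' ∈ (halfEdgesAt d a.1).erase a,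
            ∑ b ∈ (Finset.univ : Finset (V × Fin d)).erase a,
              ∑ b' ∈ (((halfEdgesAt d b.1).erase b).erase a).erase a', X.card := by
          refine Finset.sum_le_sum fun a' ha' => Finset.sum_le_sum fun b hb =>
            Finset.sum_le_sum fun b' hb' => ?_
          simp only [Finset.mem_erase] at ha' hb hb'
          exact card_pairings_filter_two hb.1.symm hb'.2.1 hb'.2.2.1 hb'.1
      _ ≤ ∑ a' ∈ (halfEdgesAt d a.1).erase a,
            ∑ b ∈ (Finset.univ : Finset (V × Fin d)).erase a, d * X.card := by
          refine Finset.sum_le_sum fun a' _ => Finset.sum_le_sum fun b _ => ?_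
          rw [Finset.sum_const, smul_eq_mul]
          exact Nat.mul_le_mul_right _ (Finset.card_erase_le.trans (Finset.card_erase_le.trans
            (Finset.card_erase_le.trans (card_halfEdgesAt _).le)))
      _ ≤ ∑ a' ∈ (halfEdgesAt d a.1).erase a, m * (d * X.card) := by
          refine Finset.sum_le_sum fun a' _ => ?_
          rw [Finset.sum_const, smul_eq_mul]
          exact Nat.mul_le_mul_right _ Finset.card_erase_le
      _ ≤ d * (m * (d * X.card)) := by
          rw [Finset.sum_const, smul_eq_mul]
          exact Nat.mul_le_mul_right _ (Finset.card_erase_le.trans (card_halfEdgesAt _).le)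
  calc _ ≤ (m - 3) ^ 2 * (_ + _) :=
        Nat.mul_le_mul_left _ ((Finset.card_le_card hsub).trans (Finset.card_union_le _ _))
    _ ≤ (m - 3) * (d * X.card) + d * (m * (d * X.card)) := by
        rw [mul_add]
        refine Nat.add_le_add ?_ h2
        rw [pow_two, mul_assoc]
        exact Nat.mul_le_mul_left _ h1
    _ ≤ m * (d ^ 2 * X.card) + d * (m * (d * X.card)) := by
        refine Nat.add_le_add_right (Nat.mul_le_mul (Nat.sub_le _ _)
          (Nat.mul_le_mul_right _ ?_)) _
        nlinarith
    _ = 2 * d ^ 2 * m * X.card := by ring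

/-- At least half of the pairings have at most `16 d ^ 2` bad half-edges (Markov's inequality). -/
theorem card_pairings_le_two_mul (hm : 6 ≤ Fintype.card (V × Fin d)) :
    (pairings (V × Fin d)).card ≤
      2 * ((pairings (V × Fin d)).filter fun σ => (badHalfEdges σ).card ≤ 16 * d ^ 2).card := by
  set m := Fintype.card (V × Fin d)
  set X := pairings (V × Fin d)
  have hsum : (m - 3) ^ 2 * ∑ σ ∈ X, (badHalfEdges σ).card ≤
      (m - 3) ^ 2 * (8 * d ^ 2 * X.card) := by
    have : ∑ σ ∈ X, (badHalfEdges σ).card =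
        ∑ a : V × Fin d, (X.filter fun σ => a ∈ badHalfEdges σ).card := by
      simp only [Finset.card_eq_sum_ones, Finset.sum_filter]
      rw [Finset.sum_comm]
      refine Finset.sum_congr rfl fun σ _ => ?_
      rw [← Finset.sum_filter]
      simp
    rw [this, Finset.mul_sum]
    calc _ ≤ ∑ a : V × Fin d, 2 * d ^ 2 * m * X.card :=
          Finset.sum_le_sum fun a _ => card_filter_mem_badHalfEdges_le a
      _ = m ^ 2 * (2 * d ^ 2 * X.card) := by
          rw [Finset.sum_const, Finset.card_univ, smul_eq_mul]; ring
      _ ≤ (2 * (m - 3)) ^ 2 * (2 * d ^ 2 * X.card) :=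
          Nat.mul_le_mul_right _ (Nat.pow_le_pow_left (by omega) 2)
      _ = _ := by ring
  have hsum' : ∑ σ ∈ X, (badHalfEdges σ).card ≤ 8 * d ^ 2 * X.card :=
    Nat.le_of_mul_le_mul_left hsum (pow_pos (by omega) 2)
  have hpart := Finset.card_filter_add_card_filter_not (s := X)
    (fun σ => (badHalfEdges σ).card ≤ 16 * d ^ 2)
  set Y := X.filter fun σ => (badHalfEdges σ).card ≤ 16 * d ^ 2
  set Z := X.filter fun σ => ¬ (badHalfEdges σ).card ≤ 16 * d ^ 2
  have hZ : (16 * d ^ 2 + 1) * Z.card ≤ 8 * d ^ 2 * X.card := by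
    refine le_trans ?_ hsum'
    calc (16 * d ^ 2 + 1) * Z.card = ∑ σ ∈ Z, (16 * d ^ 2 + 1) := by
          rw [Finset.sum_const, smul_eq_mul, mul_comm]
      _ ≤ ∑ σ ∈ Z, (badHalfEdges σ).card := Finset.sum_le_sum fun σ hσ => by
          have := (Finset.mem_filter.1 hσ).2; omega
      _ ≤ _ := Finset.sum_le_sum_of_subset (Finset.filter_subset _ _)
  have hd : 1 ≤ d ^ 2 := by
    rcases Nat.eq_zero_or_pos d with rfl | h
    · simp [m] at hm
    · exact Nat.one_le_pow _ _ h
  have : d ^ 2 * (2 * Z.card) ≤ d ^ 2 * X.card := by nlinarith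
  have := Nat.le_of_mul_le_mul_left this hd
  omega

end Simple

section Switching

variable {V : Type*} [Fintype V] [DecidableEq V] {d : ℕ}

/-- Replacing the pairs `{a, σ a}`, `{c, σ c}` of a pairing by `{a, c}`, `{σ a, σ c}` is the
conjugation by a transposition. If `a` is bad and `c` is far from `a`, then this repairs `a` and
creates no bad half-edges. -/
theorem badHalfEdges_conj_swap_ssubset {σ : Equiv.Perm (V × Fin d)}
    (hσ : σ ∈ pairings (V × Fin d)) {a c : V × Fin d} (ha : a ∈ badHalfEdges σ)
    (hc : c ∉ badHalfEdges σ)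
    (h1 : ∀ g, (g = a ∨ g = σ a ∨ (σ g).1 = a.1 ∨ (σ g).1 = (σ a).1) → g.1 ≠ c.1)
    (h2 : ∀ g, (g = a ∨ g = σ a ∨ (σ g).1 = a.1 ∨ (σ g).1 = (σ a).1) → g.1 ≠ (σ c).1) :
    badHalfEdges (Equiv.swap (σ a) c * σ * (Equiv.swap (σ a) c)⁻¹) ⊂ badHalfEdges σ := by
  have hp := mem_pairings.1 hσ
  set τ := Equiv.swap (σ a) c * σ * (Equiv.swap (σ a) c)⁻¹ with hτ
  have hac : a ≠ c := fun h => h1 a (Or.inl rfl) (by rw [h])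
  have hbc : σ a ≠ c := fun h => h1 (σ a) (Or.inr (Or.inl rfl)) (by rw [h])
  have hae : a ≠ σ c := fun h => h2 a (Or.inl rfl) (by rw [← h])
  have hba : σ a ≠ a := (hp a).2
  have hec : σ c ≠ c := (hp c).2
  have hbe : σ a ≠ σ c := fun h => hac (σ.injective h)
  have ta : τ a = c := by
    simp [hτ, Equiv.swap_apply_of_ne_of_ne hba.symm hac]
  have tb : τ (σ a) = σ c := by
    simp [hτ, Equiv.swap_apply_of_ne_of_ne hbe.symm hec]
  have tc : τ c = a := by
    simp [hτ, (hp a).1, Equiv.swap_apply_of_ne_of_ne hba.symm hac]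
  have te : τ (σ c) = σ a := by
    simp [hτ, (hp c).1, Equiv.swap_apply_of_ne_of_ne hbe.symm hec]
  have tg : ∀ g, g ≠ a → g ≠ σ a → g ≠ c → g ≠ σ c → τ g = σ g := by
    intro g g1 g2 g3 g4
    have k1 : σ g ≠ σ a := fun h => g1 (σ.injective h)
    have k2 : σ g ≠ c := fun h => g4 (by rw [← h, (hp g).1])
    simp [hτ, Equiv.swap_apply_of_ne_of_ne g2 g3, Equiv.swap_apply_of_ne_of_ne k1 k2]
  have hzw : (σ c).1 ≠ c.1 := fun h => hc (mem_badHalfEdges.2 (Or.inl h))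
  have hxz := h1 a (Or.inl rfl)
  have hyz := h1 (σ a) (Or.inr (Or.inl rfl))
  have hxw := h2 a (Or.inl rfl)
  have hyw := h2 (σ a) (Or.inr (Or.inl rfl))
  -- no pair joins the vertex of `a` or `σ a` to the vertex of `c` or `σ c`
  have n1 : ∀ g, g.1 = c.1 → (σ g).1 ≠ a.1 ∧ (σ g).1 ≠ (σ a).1 := fun g hg =>
    ⟨fun h => h1 g (by simp [h]) hg, fun h => h1 g (by simp [h]) hg⟩
  have n2 : ∀ g, g.1 = (σ c).1 → (σ g).1 ≠ a.1 ∧ (σ g).1 ≠ (σ a).1 := fun g hg =>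
    ⟨fun h => h2 g (by simp [h]) hg, fun h => h2 g (by simp [h]) hg⟩
  have n3 : ∀ g, (g.1 = a.1 ∨ g.1 = (σ a).1) → (σ g).1 ≠ c.1 ∧ (σ g).1 ≠ (σ c).1 := by
    intro g hg
    refine ⟨fun h => ?_, fun h => ?_⟩
    · have := n1 (σ g) h
      rw [(hp g).1] at this
      tauto
    · have := n2 (σ g) h
      rw [(hp g).1] at this
      tauto
  have hna : a ∉ badHalfEdges τ := by
    rw [mem_badHalfEdges, ta]
    rintro (h | ⟨g, g1, g2, g3⟩)
    · exact hxz h.symm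
    · by_cases e1 : g = σ a
      · rw [e1, tb] at g3; exact hzw g3
      by_cases e2 : g = c
      · rw [e2] at g2; exact hxz g2.symm
      by_cases e3 : g = σ c
      · rw [e3] at g2; exact hxw g2.symm
      rw [tg g g1 e1 e2 e3] at g3
      exact (n3 g (Or.inl g2)).1 g3
  have hnb : σ a ∉ badHalfEdges τ := by
    rw [mem_badHalfEdges, tb]
    rintro (h | ⟨g, g1, g2, g3⟩)
    · exact hyw h.symm
    · by_cases e1 : g = a
      · rw [e1, ta] at g3; exact hzw g3.symm
      by_cases e2 : g = c
      · rw [e2] at g2; exact hyz g2.symm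
      by_cases e3 : g = σ c
      · rw [e3] at g2; exact hyw g2.symm
      rw [tg g e1 g1 e2 e3] at g3
      exact (n3 g (Or.inr g2)).2 g3
  have hnc : c ∉ badHalfEdges τ := by
    rw [mem_badHalfEdges, tc]
    rintro (h | ⟨g, g1, g2, g3⟩)
    · exact hxz h
    · by_cases e1 : g = a
      · rw [e1] at g2; exact hxz g2
      by_cases e2 : g = σ a
      · rw [e2] at g2; exact hyz g2
      by_cases e3 : g = σ c
      · rw [e3] at g2; exact hzw g2
      rw [tg g e1 e2 g1 e3] at g3
      exact (n1 g g2).1 g3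
  have hne : σ c ∉ badHalfEdges τ := by
    rw [mem_badHalfEdges, te]
    rintro (h | ⟨g, g1, g2, g3⟩)
    · exact hyw h
    · by_cases e1 : g = a
      · rw [e1] at g2; exact hxw g2
      by_cases e2 : g = σ a
      · rw [e2] at g2; exact hyw g2
      by_cases e3 : g = c
      · rw [e3] at g2; exact hzw g2.symm
      rw [tg g e1 e2 e3 g1] at g3
      exact (n2 g g2).2 g3
  refine Finset.ssubset_iff_subset_ne.2 ⟨fun g hg => ?_, fun h => hna (h ▸ ha)⟩
  have e1 : g ≠ a := fun h => hna (h ▸ hg)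
  have e2 : g ≠ σ a := fun h => hnb (h ▸ hg)
  have e3 : g ≠ c := fun h => hnc (h ▸ hg)
  have e4 : g ≠ σ c := fun h => hne (h ▸ hg)
  rw [mem_badHalfEdges, tg g e1 e2 e3 e4] at hg
  rw [mem_badHalfEdges]
  refine hg.imp id ?_
  rintro ⟨f, f1, f2, f3⟩
  refine ⟨f, f1, f2, ?_⟩
  -- the new pairs are not parallel to any other pair
  by_cases k1 : f = a
  · rw [k1, ta] at f3; rw [k1] at f2
    exact absurd f3.symm (n3 g (Or.inl f2.symm)).1
  by_cases k2 : f = σ a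
  · rw [k2, tb] at f3; rw [k2] at f2
    exact absurd f3.symm (n3 g (Or.inr f2.symm)).2
  by_cases k3 : f = c
  · rw [k3, tc] at f3; rw [k3] at f2
    exact absurd f3.symm (n1 g f2.symm).1
  by_cases k4 : f = σ c
  · rw [k4, te] at f3; rw [k4] at f2
    exact absurd f3.symm (n2 g f2.symm).2
  rwa [tg f k1 k2 k3 k4] at f3

/-- With few bad half-edges there is room for a switching that repairs one of them. -/
theorem exists_conj_swap_card_badHalfEdges_lt {σ : Equiv.Perm (V × Fin d)}
    (hσ : σ ∈ pairings (V × Fin d)) (hne : (badHalfEdges σ).Nonempty)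
    (hm : 4 * d * (d + 1) + (badHalfEdges σ).card < Fintype.card (V × Fin d)) :
    ∃ b c, (badHalfEdges (Equiv.swap b c * σ * (Equiv.swap b c)⁻¹)).card <
      (badHalfEdges σ).card := by
  obtain ⟨a, ha⟩ := hne
  have hp := mem_pairings.1 hσ
  -- the vertices of `a` and `σ a` and their neighbors; `c` and `σ c` have to avoid them
  let Z : Finset V := {a.1, (σ a).1} ∪
    ((halfEdgesAt d a.1).image (fun g => (σ g).1) ∪
      (halfEdgesAt d (σ a).1).image fun g => (σ g).1)
  have hZ : Z.card ≤ 2 * (d + 1) := by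
    refine (Finset.card_union_le _ _).trans ?_
    have h1 := Finset.card_le_two (a := a.1) (b := (σ a).1)
    have h2 := (Finset.card_union_le ((halfEdgesAt d a.1).image fun g => (σ g).1)
      ((halfEdgesAt d (σ a).1).image fun g => (σ g).1))
    have h3 := (Finset.card_image_le (s := halfEdgesAt d a.1) (f := fun g => (σ g).1)).trans_eq
      (card_halfEdgesAt _)
    have h4 := (Finset.card_image_le (s := halfEdgesAt d (σ a).1)
      (f := fun g => (σ g).1)).trans_eq (card_halfEdgesAt _)
    omega
  have hmemZ : ∀ g : V × Fin d,
      (g = a ∨ g = σ a ∨ (σ g).1 = a.1 ∨ (σ g).1 = (σ a).1) → g.1 ∈ Z := by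
    intro g hg
    simp only [Z, Finset.mem_union, Finset.mem_insert, Finset.mem_singleton, Finset.mem_image,
      mem_halfEdgesAt]
    rcases hg with rfl | rfl | h | h
    · simp
    · simp
    · exact Or.inr (Or.inl ⟨σ g, h, by rw [(hp g).1]⟩)
    · exact Or.inr (Or.inr ⟨σ g, h, by rw [(hp g).1]⟩)
  let F : Finset (V × Fin d) := Z.biUnion fun z => halfEdgesAt d z
  have hF : F.card ≤ 2 * (d + 1) * d := by
    refine Finset.card_biUnion_le.trans ?_
    simp only [card_halfEdgesAt, Finset.sum_const, smul_eq_mul]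
    exact Nat.mul_le_mul_right _ hZ
  have hmemF : ∀ g : V × Fin d, g.1 ∈ Z → g ∈ F := fun g hg =>
    Finset.mem_biUnion.2 ⟨g.1, hg, mem_halfEdgesAt.2 rfl⟩
  have hcard : (badHalfEdges σ ∪ (F ∪ F.image σ)).card < Fintype.card (V × Fin d) := by
    have h1 := Finset.card_union_le (badHalfEdges σ) (F ∪ F.image σ)
    have h2 := Finset.card_union_le F (F.image σ)
    have h3 := Finset.card_image_le (s := F) (f := σ)
    have h4 : 4 * d * (d + 1) = 2 * (2 * (d + 1) * d) := by ring
    omega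
  obtain ⟨c, hc⟩ : ∃ c, c ∉ badHalfEdges σ ∪ (F ∪ F.image σ) := by
    by_contra! h
    exact hcard.ne (by rw [Finset.eq_univ_iff_forall.2 h, Finset.card_univ])
  simp only [Finset.mem_union, not_or] at hc
  refine ⟨σ a, c, Finset.card_lt_card (badHalfEdges_conj_swap_ssubset hσ ha hc.1 ?_ ?_)⟩
  · exact fun g hg h => hc.2.1 (hmemF c (h ▸ hmemZ g hg))
  · exact fun g hg h => hc.2.2 (Finset.mem_image.2 ⟨σ c, hmemF _ (h ▸ hmemZ g hg), (hp c).1⟩)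

/-- The pairings without loops and multiple edges; these are the ones that come from simple
graphs. -/
def simplePairings (V : Type*) [Fintype V] [DecidableEq V] (d : ℕ) :
    Finset (Equiv.Perm (V × Fin d)) :=
  (pairings (V × Fin d)).filter fun σ => badHalfEdges σ = ∅

/-- Undoing a switching is again a conjugation by a transposition, so each of the `k` repairs loses
at most a factor `m ^ 2`. -/
theorem card_filter_badHalfEdges_le (k : ℕ) (hm : 4 * d * (d + 1) + k < Fintype.card (V × Fin d)) :
    ((pairings (V × Fin d)).filter fun σ => (badHalfEdges σ).card ≤ k).card ≤
      Fintype.card (V × Fin d) ^ (2 * k) * (simplePairings V d).card := by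
  induction k with
  | zero => simp [simplePairings]
  | succ k ih =>
    set m := Fintype.card (V × Fin d)
    set Y := (pairings (V × Fin d)).filter fun σ => (badHalfEdges σ).card ≤ k
    have hsub : ((pairings (V × Fin d)).filter fun σ => (badHalfEdges σ).card ≤ k + 1) ⊆
        ((Finset.univ : Finset ((V × Fin d) × (V × Fin d))) ×ˢ Y).image
          fun q => Equiv.swap q.1.1 q.1.2 * q.2 * (Equiv.swap q.1.1 q.1.2)⁻¹ := by
      intro σ hσ
      rw [Finset.mem_filter] at hσ
      rw [Finset.mem_image]
      have hrev : ∀ b c : V × Fin d, Equiv.swap b c * (Equiv.swap b c * σ * (Equiv.swap b c)⁻¹) *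
          (Equiv.swap b c)⁻¹ = σ := by
        intro b c
        rw [Equiv.swap_inv, mul_assoc, mul_assoc, mul_assoc, Equiv.swap_mul_self, mul_one,
          ← mul_assoc, Equiv.swap_mul_self, one_mul]
      by_cases hne : (badHalfEdges σ).Nonempty
      · obtain ⟨b, c, hbc⟩ := exists_conj_swap_card_badHalfEdges_lt hσ.1 hne (by omega)
        exact ⟨((b, c), _), Finset.mem_product.2 ⟨Finset.mem_univ _,
          Finset.mem_filter.2 ⟨conj_mem_pairings hσ.1 (Equiv.swap b c),
            Nat.le_of_lt_succ (hbc.trans_le hσ.2)⟩⟩, hrev b c⟩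
      · obtain ⟨b⟩ : Nonempty (V × Fin d) := Fintype.card_pos_iff.1 (by omega)
        refine ⟨((b, b), σ), Finset.mem_product.2 ⟨Finset.mem_univ _,
          Finset.mem_filter.2 ⟨hσ.1, ?_⟩⟩, by rw [Equiv.swap_self]; rfl⟩
        rw [Finset.not_nonempty_iff_eq_empty.1 hne]; simp
    calc _ ≤ _ := Finset.card_le_card hsub
      _ ≤ _ := Finset.card_image_le
      _ = m * m * Y.card := by
          rw [Finset.card_product, Finset.card_univ, Fintype.card_prod]
      _ ≤ m * m * (m ^ (2 * k) * (simplePairings V d).card) :=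
          Nat.mul_le_mul_left _ (ih (by omega))
      _ = m ^ (2 * (k + 1)) * (simplePairings V d).card := by ring

/-- A polynomial fraction of all pairings is simple. -/
theorem card_pairings_le_card_simplePairings
    (hm : 4 * d * (d + 1) + 16 * d ^ 2 + 6 ≤ Fintype.card (V × Fin d)) :
    (pairings (V × Fin d)).card ≤
      2 * (Fintype.card (V × Fin d) ^ (2 * (16 * d ^ 2)) * (simplePairings V d).card) :=
  (card_pairings_le_two_mul (by omega)).trans
    (Nat.mul_le_mul_left _ (card_filter_badHalfEdges_le _ (by omega)))

end Switching

/-! ### Simple pairings and regular graphs -/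

section Fibers

open scoped Nat

variable {V : Type*} [Fintype V] [DecidableEq V] {d : ℕ}

/-- The graph obtained from a pairing of half-edges by joining the end points of each pair. -/
def pairingGraph (σ : Equiv.Perm (V × Fin d)) : SimpleGraph V :=
  SimpleGraph.fromRel fun x y => ∃ i, (σ (x, i)).1 = y

theorem mem_simplePairings {σ : Equiv.Perm (V × Fin d)} :
    σ ∈ simplePairings V d ↔ (∀ a, σ (σ a) = a) ∧ (∀ a, (σ a).1 ≠ a.1) ∧
      ∀ x i j, (σ (x, i)).1 = (σ (x, j)).1 → i = j := by
  rw [simplePairings, Finset.mem_filter, mem_pairings, Finset.eq_empty_iff_forall_notMem]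
  simp only [mem_badHalfEdges, not_or, not_exists, not_and]
  constructor
  · rintro ⟨h1, h2⟩
    refine ⟨fun a => (h1 a).1, fun a => (h2 a).1, fun x i j h => ?_⟩
    by_contra hij
    exact (h2 (x, j)).2 (x, i) (by simpa using hij) rfl h
  · rintro ⟨h1, h2, h3⟩
    refine ⟨fun a => ⟨h1 a, fun h => h2 a (by rw [h])⟩, fun a => ⟨h2 a, ?_⟩⟩
    rintro ⟨x, i⟩ hne rfl h
    exact hne (by rw [h3 _ i a.2 h])

theorem pairingGraph_adj {σ : Equiv.Perm (V × Fin d)} (hσ : σ ∈ simplePairings V d) {x y : V} :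
    (pairingGraph σ).Adj x y ↔ ∃ i, (σ (x, i)).1 = y := by
  obtain ⟨h1, h2, -⟩ := mem_simplePairings.1 hσ
  have hsymm : ∀ x y, (∃ i, (σ (x, i)).1 = y) → ∃ i, (σ (y, i)).1 = x := by
    rintro x _ ⟨i, rfl⟩
    exact ⟨(σ (x, i)).2, by simp [h1]⟩
  rw [pairingGraph, SimpleGraph.fromRel_adj]
  constructor
  · rintro ⟨-, h | h⟩
    exacts [h, hsymm _ _ h]
  · intro h
    refine ⟨?_, Or.inl h⟩
    rintro rfl
    obtain ⟨i, hi⟩ := h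
    exact h2 (x, i) hi

theorem mem_regularGraphs_iff {n : ℕ} {G : SimpleGraph (Fin n)} :
    G ∈ regularGraphs d n ↔ ∀ x, Nat.card (G.neighborSet x) = d := by
  classical
  rw [regularGraphs, Set.mem_ofPred_eq, SimpleGraph.IsRegularOfDegree]
  refine forall_congr' fun x => ?_
  rw [← SimpleGraph.card_neighborSet_eq_degree, Nat.card_eq_fintype_card]

theorem pairingGraph_mem_regularGraphs {n : ℕ} {σ : Equiv.Perm (Fin n × Fin d)}
    (hσ : σ ∈ simplePairings (Fin n) d) : pairingGraph σ ∈ regularGraphs d n := by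
  rw [mem_regularGraphs_iff]
  intro x
  obtain ⟨-, -, h3⟩ := mem_simplePairings.1 hσ
  rw [← Nat.card_congr (Equiv.ofBijective
    (fun i : Fin d => (⟨(σ (x, i)).1, (pairingGraph_adj hσ).2 ⟨i, rfl⟩⟩ :
      (pairingGraph σ).neighborSet x)) ⟨?_, ?_⟩)]
  · simp
  · intro i j h
    exact h3 x i j (congrArg Subtype.val h)
  · rintro ⟨y, hy⟩
    obtain ⟨i, hi⟩ := (pairingGraph_adj hσ).1 hy
    exact ⟨i, Subtype.ext hi⟩

/-- The pairing in which the half-edges at each vertex `x` are attached to the neighbors of `x` by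
the bijection `l x`. -/
def labelledPairing {G : SimpleGraph V} (l : ∀ x, Fin d ≃ G.neighborSet x) :
    Equiv.Perm (V × Fin d) :=
  Function.Involutive.toPerm
    (fun a => ((l a.1 a.2 : V), (l (l a.1 a.2)).symm ⟨a.1, (l a.1 a.2).2.symm⟩))
    (by
      rintro ⟨x, i⟩
      have key : ∀ z : G.neighborSet (l x i), z = ⟨x, (l x i).2.symm⟩ →
          (l z).symm ⟨l x i, z.2.symm⟩ = i := by
        rintro _ rfl
        exact (l x).symm_apply_apply i
      exact Prod.ext (by simp) (key _ (Equiv.apply_symm_apply _ _)))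

theorem labelledPairing_fst {V : Type*} {d : ℕ} {G : SimpleGraph V}
    (l : ∀ x, Fin d ≃ G.neighborSet x) (a : V × Fin d) : (labelledPairing l a).1 = l a.1 a.2 := rfl

theorem labelledPairing_partner {V : Type*} {d : ℕ} {G : SimpleGraph V}
    (l : ∀ x, Fin d ≃ G.neighborSet x) (a : V × Fin d) :
    (l (labelledPairing l a).1 (labelledPairing l a).2 : V) = a.1 :=
  congrArg Subtype.val ((l (l a.1 a.2)).apply_symm_apply _)

open scoped Classical in
/-- A `d`-regular graph on `n` vertices comes from exactly `(d!) ^ n` pairings. -/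
theorem card_filter_pairingGraph_eq {n : ℕ} {G : SimpleGraph (Fin n)}
    (hG : G ∈ regularGraphs d n) :
    ((simplePairings (Fin n) d).filter fun σ => pairingGraph σ = G).card = (d !) ^ n := by
  rw [mem_regularGraphs_iff] at hG
  have hc : Fintype.card (∀ x, Fin d ≃ G.neighborSet x) = (d !) ^ n := by
    rw [Fintype.card_pi]
    have : ∀ x, Fintype.card (Fin d ≃ G.neighborSet x) = d ! := by
      intro x
      have e : Fin d ≃ G.neighborSet x := Fintype.equivOfCardEq (by
        rw [Fintype.card_fin, ← Nat.card_eq_fintype_card, hG])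
      rw [Fintype.card_equiv e, Fintype.card_fin]
    simp [this]
  rw [← hc, ← Finset.card_univ]
  symm
  have happ : ∀ (l : ∀ x, Fin d ≃ G.neighborSet x) (x i), (labelledPairing l (x, i)).1 = l x i :=
    fun _ _ _ => rfl
  have hs : ∀ l : ∀ x, Fin d ≃ G.neighborSet x, labelledPairing l ∈ simplePairings (Fin n) d := by
    intro l
    refine mem_simplePairings.2 ⟨fun a => Function.Involutive.toPerm_involutive _ a, ?_, ?_⟩
    · rintro ⟨x, i⟩ h
      rw [happ] at h
      exact G.ne_of_adj (l x i).2 h.symm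
    · intro x i j h
      rw [happ, happ] at h
      exact (l x).injective (Subtype.ext h)
  refine Finset.card_bij (fun l _ => labelledPairing l) ?_ ?_ ?_
  · intro l _
    refine Finset.mem_filter.2 ⟨hs l, ?_⟩
    ext x y
    rw [pairingGraph_adj (hs l)]
    simp only [happ]
    constructor
    · rintro ⟨i, rfl⟩
      exact (l x i).2
    · intro h
      exact ⟨(l x).symm ⟨y, h⟩, by simp⟩
  · intro l _ l' _ h
    ext x i
    have := congrArg (fun σ : Equiv.Perm (Fin n × Fin d) => (σ (x, i)).1) h
    simp only [happ] at this
    rw [this]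
  · intro σ hσ
    rw [Finset.mem_filter] at hσ
    obtain ⟨hσ, rfl⟩ := hσ
    obtain ⟨h1, h2, h3⟩ := mem_simplePairings.1 hσ
    obtain ⟨l, hl⟩ : ∃ l : ∀ x, Fin d ≃ (pairingGraph σ).neighborSet x,
        ∀ x i, (l x i : Fin n) = (σ (x, i)).1 :=
      ⟨fun x => Equiv.ofBijective
        (fun i : Fin d => ⟨(σ (x, i)).1, (pairingGraph_adj hσ).2 ⟨i, rfl⟩⟩)
        ⟨fun i j h => h3 x i j (congrArg Subtype.val h), by
          rintro ⟨y, hy⟩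
          obtain ⟨i, hi⟩ := (pairingGraph_adj hσ).1 hy
          exact ⟨i, Subtype.ext hi⟩⟩, fun _ _ => rfl⟩
    refine ⟨l, Finset.mem_univ _, ?_⟩
    ext1 ⟨x, i⟩
    have hfst : (labelledPairing l (x, i)).1 = (σ (x, i)).1 := by
      rw [labelledPairing_fst, hl]
    refine Prod.ext hfst (h3 (σ (x, i)).1 _ _ ?_)
    rw [← hfst, ← hl, labelledPairing_partner, hfst, h1]

open scoped Classical in
theorem card_filter_pairingGraph_mem {n : ℕ} (E : Finset (SimpleGraph (Fin n)))
    (hE : ∀ G ∈ E, G ∈ regularGraphs d n) :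
    ((simplePairings (Fin n) d).filter fun σ => pairingGraph σ ∈ E).card =
      E.card * (d !) ^ n := by
  rw [Finset.card_eq_sum_card_fiberwise (f := pairingGraph) (t := E)
    (s := (simplePairings (Fin n) d).filter fun σ => pairingGraph σ ∈ E)
    (fun σ hσ => (Finset.mem_filter.1 hσ).2)]
  rw [Finset.sum_congr rfl (g := fun _ => (d !) ^ n), Finset.sum_const, smul_eq_mul]
  intro G hG
  rw [← card_filter_pairingGraph_eq (hE G hG), Finset.filter_filter]
  congr 1
  refine Finset.filter_congr fun σ _ => ⟨fun h => h.2, fun h => ⟨h ▸ hG, h⟩⟩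

end Fibers

/-! ### Entropy and the number of words of a given type -/

section Types

open scoped Nat
open Real

/-- The entropy of the empirical distribution `N / m`, where `N` counts the letters of a word of
length `m`. -/
noncomputable def typeEntropy {K : Type*} [Fintype K] (N : K → ℕ) (m : ℕ) : ℝ :=
  ∑ k, negMulLog (N k / m)

theorem prod_pow_type {K : Type*} [Fintype K] (N : K → ℕ) {m : ℕ} (hm : 0 < m) :
    ∏ k, ((N k : ℝ) / m) ^ N k = exp (-(m * typeEntropy N m)) := by
  have hm' : (m : ℝ) ≠ 0 := by positivity
  rw [typeEntropy, Finset.mul_sum, ← Finset.sum_neg_distrib, exp_sum]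
  refine Finset.prod_congr rfl fun k _ => ?_
  rcases Nat.eq_zero_or_pos (N k) with h | h
  · simp [h]
  · rw [negMulLog, ← exp_log (show (0 : ℝ) < N k / m by positivity), ← exp_nat_mul,
      log_exp, exp_log (by positivity)]
    congr 1
    field_simp

/-- If every word of `Q` has probability at least `c` under independent letters of law `p`, then
`Q` has at most `1 / c` elements. -/
theorem card_mul_le_one {R K : Type*} [Fintype R] [Fintype K] [DecidableEq R] (p : K → ℝ)
    (hp : ∀ k, 0 ≤ p k) (hp1 : ∑ k, p k = 1) (Q : Finset (R → K)) {c : ℝ}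
    (hc : ∀ g ∈ Q, c ≤ ∏ r, p (g r)) : Q.card * c ≤ 1 := by
  classical
  calc Q.card * c = ∑ g ∈ Q, c := by simp
    _ ≤ ∑ g ∈ Q, ∏ r, p (g r) := Finset.sum_le_sum hc
    _ ≤ ∑ g : R → K, ∏ r, p (g r) :=
        Finset.sum_le_univ_sum_of_nonneg fun g => Finset.prod_nonneg fun r _ => hp _
    _ = ∏ r : R, ∑ k, p k := by rw [Finset.prod_univ_sum, Fintype.piFinset_univ]
    _ = 1 := by simp [hp1]

theorem prod_apply_eq_prod_pow {A K : Type*} [Fintype A] [Fintype K] [DecidableEq K]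
    (p : K → ℝ) (g : A → K) :
    ∏ a, p (g a) = ∏ k, p k ^ (Finset.univ.filter fun a => g a = k).card := by
  rw [← Finset.prod_fiberwise' _ g p]
  simp

theorem card_filter_type_le {A K : Type*} [Fintype A] [DecidableEq A] [Nonempty A] [Fintype K]
    [DecidableEq K] (N : K → ℕ) :
    ((Finset.univ.filter fun g : A → K =>
      ∀ k, (Finset.univ.filter fun a => g a = k).card = N k).card : ℝ) ≤
      exp (Fintype.card A * typeEntropy N (Fintype.card A)) := by
  set m := Fintype.card A with hmdef
  have hm : 0 < m := Fintype.card_pos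
  set Q := Finset.univ.filter fun g : A → K =>
    ∀ k, (Finset.univ.filter fun a => g a = k).card = N k
  rcases Q.eq_empty_or_nonempty with h | ⟨g₀, hg₀⟩
  · rw [h]; simp [exp_nonneg]
  have hN : ∑ k, N k = m := by
    rw [hmdef, ← Finset.card_univ, Finset.card_eq_sum_card_fiberwise (f := g₀) (t := Finset.univ)
      (s := Finset.univ) (fun _ _ => Finset.mem_coe.2 (Finset.mem_univ _))]
    exact Finset.sum_congr rfl fun k _ => ((Finset.mem_filter.1 hg₀).2 k).symm
  have h1 := card_mul_le_one (fun k => (N k : ℝ) / m) (fun k => by positivity)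
    (by rw [← Finset.sum_div, ← Nat.cast_sum, hN, div_self (by positivity)]) Q
    (c := exp (-(m * typeEntropy N m))) (fun g hg => by
      rw [← prod_pow_type N hm, prod_apply_eq_prod_pow (fun k => (N k : ℝ) / m) g]
      refine (Finset.prod_congr rfl fun k _ => ?_).le
      rw [(Finset.mem_filter.1 hg).2 k])
  rwa [exp_neg, ← div_eq_mul_inv, div_le_one (exp_pos _)] at h1

/-- Since `log 0 = 0`, the bound also holds for `n = 0`. -/
theorem log_factorial_le (n : ℕ) : log (n ! : ℝ) ≤ n * log n - n + log n + 1 := by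
  rcases Nat.eq_zero_or_pos n with rfl | h
  · simp
  induction n, h using Nat.le_induction with
  | base => simp
  | succ n hn ih =>
    have hn' : (0 : ℝ) < n := by exact_mod_cast hn
    rw [Nat.factorial_succ, Nat.cast_mul, log_mul (by positivity) (by positivity)]
    have h1 := one_sub_inv_le_log_of_pos (show (0 : ℝ) < (n + 1) / n by positivity)
    rw [log_div (by positivity) (by positivity), inv_div] at h1
    have h2 : 1 - (n : ℝ) / (n + 1) = 1 / (n + 1) := by field_simp; ring
    rw [h2, div_le_iff₀ (by positivity)] at h1
    push_cast
    linarith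

theorem le_log_factorial (n : ℕ) : n * log n - n ≤ log (n ! : ℝ) := by
  rcases Nat.eq_zero_or_pos n with rfl | h
  · simp
  have h1 := pow_div_factorial_le_exp (n : ℝ) (Nat.cast_nonneg n) n
  have h2 := log_le_log (by positivity) h1
  rw [log_div (by positivity) (by positivity), log_pow, log_exp] at h2
  linarith

/-- The multinomial coefficient of `D` is at least `exp (m h)` up to a polynomial factor, where `h`
is the entropy of `D / m`. -/
theorem prod_factorial_le {K : Type*} [Fintype K] (D : K → ℕ) {m : ℕ} (hm : 0 < m)
    (hD : ∑ k, D k = m) :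
    (∏ k, ((D k)! : ℝ)) ≤
      (m ! : ℝ) * exp (Fintype.card K * (log m + 1) - m * typeEntropy D m) := by
  have hm' : (0 : ℝ) < m := by exact_mod_cast hm
  have hDm : ∀ k, D k ≤ m := fun k => hD ▸ Finset.single_le_sum (fun _ _ => Nat.zero_le _)
    (Finset.mem_univ k)
  have hH : (m : ℝ) * typeEntropy D m = ∑ k, ((D k : ℝ) * log m - D k * log (D k)) := by
    rw [typeEntropy, Finset.mul_sum]
    refine Finset.sum_congr rfl fun k _ => ?_
    rcases Nat.eq_zero_or_pos (D k) with h | h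
    · simp [h]
    · rw [negMulLog, log_div (by positivity) (by positivity)]
      field_simp
      ring
  have hsum : (∑ k, (D k : ℝ)) = m := by exact_mod_cast hD
  have h1 : log (∏ k, ((D k)! : ℝ)) ≤
      log (m !) + (Fintype.card K * (log m + 1) - m * typeEntropy D m) := by
    rw [log_prod (fun k _ => by positivity)]
    calc ∑ k, log ((D k)! : ℝ)
        ≤ ∑ k, ((D k : ℝ) * log m - ((D k : ℝ) * log m - D k * log (D k)) - D k +
            (log m + 1)) := by
          refine Finset.sum_le_sum fun k _ => (log_factorial_le _).trans ?_
          have : log (D k : ℝ) ≤ log m := by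
            rcases Nat.eq_zero_or_pos (D k) with h | h
            · rw [h]; simpa using log_natCast_nonneg m
            · exact log_le_log (by exact_mod_cast h) (by exact_mod_cast hDm k)
          linarith
      _ = m * log m - m * typeEntropy D m - m + Fintype.card K * (log m + 1) := by
          rw [Finset.sum_add_distrib, Finset.sum_sub_distrib, Finset.sum_sub_distrib, ← hH,
            ← Finset.sum_mul, hsum, Finset.sum_const, Finset.card_univ, nsmul_eq_mul]
      _ ≤ _ := by linarith [le_log_factorial m]
  have h2 := exp_le_exp.2 h1
  rwa [exp_add, exp_log (Finset.prod_pos fun k _ => by positivity), exp_log (by positivity)] at h2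

end Types

/-! ### Counting pairings with given color statistics -/

section PairType

open scoped Nat
open Real

variable {A S : Type*} [Fintype A] [DecidableEq A] [Fintype S] [DecidableEq S]

/-- The number of points of each ordered pair of colors `(f a, f (σ a))` in a colored pairing. -/
def pairType (f : A → S) (σ : Equiv.Perm A) (k : S × S) : ℕ :=
  (Finset.univ.filter fun a => (f a, f (σ a)) = k).card

theorem pairType_swap {S : Type*} [DecidableEq S] (f : A → S) {σ : Equiv.Perm A}
    (hσ : σ ∈ pairings A) (s t : S) : pairType f σ (s, t) = pairType f σ (t, s) := by
  have hp := mem_pairings.1 hσ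
  refine Finset.card_bij (fun a _ => σ a) ?_ (fun a _ b _ h => σ.injective h) ?_
  · intro a ha
    simp only [Finset.mem_filter, Finset.mem_univ, true_and, Prod.mk.injEq] at ha ⊢
    rw [(hp a).1]
    exact ha.symm
  · intro a ha
    simp only [Finset.mem_filter, Finset.mem_univ, true_and, Prod.mk.injEq] at ha
    exact ⟨σ a, by simpa [(hp a).1] using ha.symm, (hp a).1⟩

theorem sum_pairType {A : Type*} [Fintype A] (f : A → S) (σ : Equiv.Perm A) :
    ∑ k, pairType f σ k = Fintype.card A := by
  rw [← Finset.card_univ, Finset.card_eq_sum_card_fiberwise (f := fun a => (f a, f (σ a)))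
    (t := Finset.univ) (s := Finset.univ) (fun _ _ => Finset.mem_coe.2 (Finset.mem_univ _))]
  rfl

theorem sum_pairType_snd {A : Type*} [Fintype A] (f : A → S) (σ : Equiv.Perm A) (s : S) :
    ∑ t, pairType f σ (s, t) = (Finset.univ.filter fun a => f a = s).card := by
  rw [Finset.card_eq_sum_card_fiberwise (f := fun a => f (σ a))
    (t := Finset.univ) (s := Finset.univ.filter fun a => f a = s)
    (fun _ _ => Finset.mem_coe.2 (Finset.mem_univ _))]
  refine Finset.sum_congr rfl fun t _ => ?_
  rw [Finset.filter_filter]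
  simp only [pairType, Prod.mk.injEq]

/-- For a fixed pairing, a coloring with given statistics amounts to a word of length `m / 2` in
pairs of colors. -/
theorem card_filter_pairType_le [Nonempty A] {σ : Equiv.Perm A} (hσ : σ ∈ pairings A)
    (M : S × S → ℕ) :
    ((Finset.univ.filter fun f : A → S => pairType f σ = M).card : ℝ) ≤
      exp (Fintype.card A / 2 * typeEntropy M (Fintype.card A)) := by
  have hp := mem_pairings.1 hσ
  set m := Fintype.card A with hmdef
  have hm : 0 < m := Fintype.card_pos
  set Q := Finset.univ.filter fun f : A → S => pairType f σ = M with hQ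
  rcases Q.eq_empty_or_nonempty with h | ⟨f₀, hf₀⟩
  · rw [h]; simp [exp_nonneg]
  replace hf₀ : pairType f₀ σ = M := (Finset.mem_filter.1 hf₀).2
  have hsymm : ∀ s t, M (s, t) = M (t, s) := fun s t => hf₀ ▸ pairType_swap f₀ hσ s t
  have hM : ∑ k, M k = m := hf₀ ▸ sum_pairType f₀ σ
  -- one point of each pair
  let e := Fintype.equivFin A
  let R := {a : A // e a < e (σ a)}
  let p : S × S → ℝ := fun k => (M k : ℝ) / m
  let F : (A → S) → (R → S × S) := fun f r => (f r, f (σ r))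
  have hF : Function.Injective F := by
    intro f g h
    ext a
    rcases lt_trichotomy (e a) (e (σ a)) with h1 | h1 | h1
    · exact (Prod.ext_iff.1 (congrFun h ⟨a, h1⟩)).1
    · exact absurd (e.injective h1).symm (hp a).2
    · have := (Prod.ext_iff.1 (congrFun h ⟨σ a, by rwa [(hp a).1]⟩)).2
      simpa [F, (hp a).1] using this
  have hprod : ∀ f ∈ Q, ∏ r, p (F f r) = exp (-(m / 2 * typeEntropy M m)) := by
    intro f hf
    have hfM : pairType f σ = M := (Finset.mem_filter.1 hf).2
    have h1 : ∏ a, p (f a, f (σ a)) = exp (-(m * typeEntropy M m)) := by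
      rw [← prod_pow_type M hm, prod_apply_eq_prod_pow p fun a => (f a, f (σ a))]
      refine Finset.prod_congr rfl fun k _ => ?_
      change p k ^ pairType f σ k = _
      rw [hfM]
    have h2 : ∏ a, p (f a, f (σ a)) = (∏ r, p (F f r)) * ∏ r, p (F f r) := by
      rw [← Finset.prod_filter_mul_prod_filter_not Finset.univ (fun a => e a < e (σ a))]
      have h3 : ∏ r, p (F f r) =
          ∏ a ∈ Finset.univ.filter (fun a => e a < e (σ a)), p (f a, f (σ a)) :=
        (Finset.prod_subtype _ (by simp) fun a => p (f a, f (σ a))).symm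
      rw [h3]
      congr 1
      refine Finset.prod_bij (fun a _ => σ a) ?_ (fun a _ b _ h => σ.injective h) ?_ ?_
      · intro a ha
        simp only [Finset.mem_filter, Finset.mem_univ, true_and, not_lt] at ha ⊢
        rw [(hp a).1]
        exact lt_of_le_of_ne ha fun h => (hp a).2 (e.injective h)
      · intro a ha
        simp only [Finset.mem_filter, Finset.mem_univ, true_and] at ha
        exact ⟨σ a, by simpa [(hp a).1] using ha.le, (hp a).1⟩
      · intro a _
        simp only [(hp a).1, p, hsymm (f a)]
    have h0 : 0 ≤ ∏ r, p (F f r) := Finset.prod_nonneg fun r _ => by positivity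
    rw [h2] at h1
    refine (mul_self_inj h0 (exp_nonneg _)).1 ?_
    rw [h1, ← exp_add]
    congr 1
    ring
  have h1 := card_mul_le_one p (fun k => by positivity)
    (by simp only [p]; rw [← Finset.sum_div, ← Nat.cast_sum, hM, div_self (by positivity)])
    (Q.image F) (c := exp (-(m / 2 * typeEntropy M m))) (fun g hg => by
      obtain ⟨f, hf, rfl⟩ := Finset.mem_image.1 hg
      exact (hprod f hf).ge)
  rw [Finset.card_image_of_injective _ hF] at h1
  rwa [exp_neg, ← div_eq_mul_inv, div_le_one (exp_pos _)] at h1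

theorem card_filter_comp_eq_le (f f' : A → S) :
    (Finset.univ.filter fun g : Equiv.Perm A => f ∘ g = f').card ≤
      ∏ s, ((Finset.univ.filter fun a => f a = s).card)! := by
  have h0 := DomMulAct.stabilizer_card f
  rw [Fintype.card_subtype] at h0
  simp only [Fintype.card_subtype] at h0
  rw [← h0]
  rcases (Finset.univ.filter fun g : Equiv.Perm A => f ∘ g = f').eq_empty_or_nonempty with
    h | ⟨g₀, hg₀⟩
  · rw [h]; simp
  replace hg₀ : f ∘ g₀ = f' := (Finset.mem_filter.1 hg₀).2
  refine Finset.card_le_card_of_injOn (fun g => g * g₀⁻¹) ?_ fun g _ h _ hgh => by simpa using hgh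
  intro g hg
  simp only [Finset.coe_filter, Finset.mem_univ, true_and, Set.mem_ofPred_eq] at hg ⊢
  ext a
  have := congrFun (hg.trans hg₀.symm) (g₀⁻¹ a)
  simpa using this

/-- The number of pairings with given color statistics is the same for all colorings with the same
color counts, so it can be bounded by averaging over the relabellings of the points. -/
theorem factorial_mul_card_filter_le [Nonempty A] (f : A → S) (M : S × S → ℕ) :
    ((Fintype.card A)! : ℝ) * ((pairings A).filter fun σ => pairType f σ = M).card ≤
      (pairings A).card * (exp (Fintype.card A / 2 * typeEntropy M (Fintype.card A)) *
        ∏ s, (((Finset.univ.filter fun a => f a = s).card)! : ℝ)) := by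
  have hconj : ∀ g : Equiv.Perm A,
      ((pairings A).filter fun σ => pairType f σ = M).card =
        ((pairings A).filter fun σ => pairType (f ∘ g) σ = M).card := by
    intro g
    have htype : ∀ σ, pairType (f ∘ g) (g⁻¹ * σ * g⁻¹⁻¹) = pairType f σ := by
      intro σ
      ext k
      refine Finset.card_bij (fun a _ => g a) ?_ (fun a _ b _ h => g.injective h) ?_
      · intro a ha
        simpa using ha
      · intro a ha
        exact ⟨g⁻¹ a, by simpa using ha, by simp⟩
    refine Finset.card_bij (fun σ _ => g⁻¹ * σ * g⁻¹⁻¹) ?_ (fun a _ b _ h => by simpa using h) ?_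
    · intro σ hσ
      rw [Finset.mem_filter] at hσ ⊢
      exact ⟨conj_mem_pairings hσ.1 _, by rw [htype, hσ.2]⟩
    · intro σ hσ
      rw [Finset.mem_filter] at hσ
      have hr : g⁻¹ * (g * σ * g⁻¹) * g⁻¹⁻¹ = σ := by group
      refine ⟨g * σ * g⁻¹, Finset.mem_filter.2 ⟨conj_mem_pairings hσ.1 _, ?_⟩, hr⟩
      rw [← htype, hr, hσ.2]
  have hcount : (Fintype.card A)! * ((pairings A).filter fun σ => pairType f σ = M).card =
      ∑ σ ∈ pairings A,
        (Finset.univ.filter fun g : Equiv.Perm A => pairType (f ∘ g) σ = M).card := by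
    calc _ = ∑ g : Equiv.Perm A, ((pairings A).filter fun σ => pairType f σ = M).card := by
          rw [Finset.sum_const, Finset.card_univ, Fintype.card_perm, smul_eq_mul]
      _ = ∑ g : Equiv.Perm A, ((pairings A).filter fun σ => pairType (f ∘ g) σ = M).card :=
          Finset.sum_congr rfl fun g _ => hconj g
      _ = _ := by
          simp only [Finset.card_eq_sum_ones, Finset.sum_filter]
          rw [Finset.sum_comm]
  have hle : ∀ σ ∈ pairings A,
      ((Finset.univ.filter fun g : Equiv.Perm A => pairType (f ∘ g) σ = M).card : ℝ) ≤
        exp (Fintype.card A / 2 * typeEntropy M (Fintype.card A)) *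
        ∏ s, (((Finset.univ.filter fun a => f a = s).card)! : ℝ) := by
    intro σ hσ
    have h1 : (Finset.univ.filter fun g : Equiv.Perm A => pairType (f ∘ g) σ = M).card ≤
        (∏ s, ((Finset.univ.filter fun a => f a = s).card)!) *
          (Finset.univ.filter fun f' : A → S => pairType f' σ = M).card := by
      refine Finset.card_le_mul_card_image_of_maps_to (f := fun g : Equiv.Perm A => f ∘ g)
        (fun g hg => ?_) _ fun f' _ => ?_
      · simpa using hg
      · refine le_trans (Finset.card_le_card ?_) (card_filter_comp_eq_le f f')
        rw [Finset.filter_filter]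
        exact Finset.monotone_filter_right _ fun g _ h => h.2
    calc _ ≤ (((∏ s, ((Finset.univ.filter fun a => f a = s).card)!) *
          (Finset.univ.filter fun f' : A → S => pairType f' σ = M).card : ℕ) : ℝ) := by
          exact_mod_cast h1
      _ ≤ _ := by
          push_cast
          rw [mul_comm]
          exact mul_le_mul_of_nonneg_right (card_filter_pairType_le hσ M)
            (Finset.prod_nonneg fun s _ => by positivity)
  calc _ = (((Fintype.card A)! *
          ((pairings A).filter fun σ => pairType f σ = M).card : ℕ) : ℝ) := by
        push_cast; rfl
    _ ≤ _ := by
        rw [hcount, Nat.cast_sum]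
        refine (Finset.sum_le_sum hle).trans_eq ?_
        rw [Finset.sum_const, nsmul_eq_mul]

theorem card_filter_pairings_pairType_le [Nonempty A] (f : A → S) (M : S × S → ℕ) :
    (((pairings A).filter fun σ => pairType f σ = M).card : ℝ) ≤
      (pairings A).card * exp (Fintype.card A / 2 * typeEntropy M (Fintype.card A) +
        (Fintype.card S * (log (Fintype.card A) + 1) -
          Fintype.card A * typeEntropy (fun s => ∑ t, M (s, t)) (Fintype.card A))) := by
  rcases ((pairings A).filter fun σ => pairType f σ = M).eq_empty_or_nonempty with h | ⟨σ, hσ⟩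
  · rw [h]; simp; positivity
  have hM : pairType f σ = M := (Finset.mem_filter.1 hσ).2
  have hD : ∀ s, (Finset.univ.filter fun a => f a = s).card = ∑ t, M (s, t) := fun s => by
    rw [← hM, sum_pairType_snd]
  have h1 := factorial_mul_card_filter_le f M
  simp only [hD] at h1
  have hsum : ∑ s, ∑ t, M (s, t) = Fintype.card A := by
    rw [← sum_pairType f σ, hM, Fintype.sum_prod_type]
  have h2 := prod_factorial_le (fun s => ∑ t, M (s, t)) Fintype.card_pos hsum
  have h3 : (0 : ℝ) < (Fintype.card A)! := by positivity
  refine le_of_mul_le_mul_left (h1.trans ?_) h3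
  rw [exp_add]
  calc _ ≤ ((pairings A).card : ℝ) * (exp (Fintype.card A / 2 * typeEntropy M (Fintype.card A)) *
        (((Fintype.card A)! : ℝ) * exp (Fintype.card S * (log (Fintype.card A) + 1) -
          Fintype.card A * typeEntropy (fun s => ∑ t, M (s, t)) (Fintype.card A)))) := by
        gcongr
    _ = _ := by ring

end PairType

/-! ### The first moment bound -/

section FirstMoment

open scoped Nat
open Real

variable {S : Type*} [Fintype S] [DecidableEq S]

open scoped Classical in
/-- The number of darts of the graph `G` with each ordered pair of colors. -/
noncomputable def dartType {V : Type*} [Fintype V] (f : V → S) (G : SimpleGraph V)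
    (k : S × S) : ℕ :=
  (Finset.univ.filter fun q : V × V => G.Adj q.1 q.2 ∧ (f q.1, f q.2) = k).card

theorem pairType_eq_dartType {S V : Type*} [DecidableEq S] [Fintype V] [DecidableEq V] {d : ℕ}
    {σ : Equiv.Perm (V × Fin d)} (hσ : σ ∈ simplePairings V d) (f : V → S) :
    pairType (f ∘ Prod.fst) σ = dartType f (pairingGraph σ) := by
  classical
  obtain ⟨h1, h2, h3⟩ := mem_simplePairings.1 hσ
  ext k
  refine Finset.card_bij (fun a _ => (a.1, (σ a).1)) ?_ ?_ ?_
  · intro a ha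
    simp only [Finset.mem_filter, Finset.mem_univ, true_and, Function.comp] at ha ⊢
    exact ⟨(pairingGraph_adj hσ).2 ⟨a.2, rfl⟩, ha⟩
  · rintro ⟨x, i⟩ _ ⟨y, j⟩ _ h
    obtain ⟨rfl, h⟩ := Prod.ext_iff.1 h
    rw [h3 _ i j h]
  · rintro ⟨x, y⟩ h
    simp only [Finset.mem_filter, Finset.mem_univ, true_and] at h
    obtain ⟨i, rfl⟩ := (pairingGraph_adj hσ).1 h.1
    exact ⟨(x, i), by simpa using h.2, rfl⟩

/-- The exponential growth rate of the expected number of colorings of a random `d`-regular graph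
whose edge statistics are given by the distribution `q` on pairs of colors. -/
noncomputable def bethe (d : ℕ) (q : S × S → ℝ) : ℝ :=
  (d : ℝ) / 2 * ∑ k, negMulLog (q k) - ((d : ℝ) - 1) * ∑ s, negMulLog (∑ t, q (s, t))

theorem card_filter_fst_eq {S V : Type*} [DecidableEq S] [Fintype V] {d : ℕ} (f : V → S) (s : S) :
    (Finset.univ.filter fun a : V × Fin d => (f ∘ Prod.fst) a = s).card =
      (Finset.univ.filter fun v => f v = s).card * d := by
  rw [← Finset.univ_product_univ, show (Finset.univ ×ˢ Finset.univ : Finset (V × Fin d)).filter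
    (fun a => (f ∘ Prod.fst) a = s) = (Finset.univ.filter fun v => f v = s) ×ˢ Finset.univ by
      ext a; simp, Finset.card_product]
  simp

/-- If a fraction `c` of the `d`-regular graphs on `n` vertices can be colored with dart statistics
in `𝓜`, then the growth rate of some member of `𝓜` is at least `-O(log n / n)`. -/
theorem exists_le_mul_bethe {n d : ℕ} (hn : 0 < n) (hd : 0 < d)
    (hm : 4 * d * (d + 1) + 16 * d ^ 2 + 6 ≤ n * d) (𝓜 : Set (S × S → ℕ))
    (E R : Finset (SimpleGraph (Fin n))) (hR : ∀ G, G ∈ R ↔ G ∈ regularGraphs d n)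
    (hR0 : R.Nonempty) (hER : E ⊆ R) {c : ℝ} (hc : 0 < c) (hE : c * R.card ≤ E.card)
    (hcol : ∀ G ∈ E, ∃ f, dartType f G ∈ 𝓜) :
    ∃ M ∈ 𝓜, log c - log 2 - 32 * d ^ 2 * log (n * d : ℕ) -
      Fintype.card S ^ 2 * log ((n * d : ℕ) + 1) - Fintype.card S * (log (n * d : ℕ) + 1) ≤
      n * bethe d (fun k => (M k : ℝ) / (n * d : ℕ)) := by
  classical
  set m := n * d with hmdef
  have hmA : Fintype.card (Fin n × Fin d) = m := by simp [hmdef]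
  have hm0 : 0 < m := by omega
  have hmR : (0 : ℝ) < m := by exact_mod_cast hm0
  have hnR : (0 : ℝ) < n := by exact_mod_cast hn
  have hdR : (0 : ℝ) < d := by exact_mod_cast hd
  have : Nonempty (Fin n) := ⟨⟨0, hn⟩⟩
  have : Nonempty (Fin d) := ⟨⟨0, hd⟩⟩
  set Xs := simplePairings (Fin n) d with hXs
  set XE := Xs.filter fun σ => pairingGraph σ ∈ E with hXE
  set X := pairings (Fin n × Fin d) with hX
  have hcE : XE.card = E.card * (d !) ^ n :=
    card_filter_pairingGraph_mem E fun G hG => (hR G).1 (hER hG)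
  have hcR : Xs.card = R.card * (d !) ^ n := by
    rw [← card_filter_pairingGraph_mem R fun G hG => (hR G).1 hG, Finset.filter_true_of_mem]
    exact fun σ hσ => (hR _).2 (pairingGraph_mem_regularGraphs hσ)
  have hXs0 : 0 < Xs.card := by
    rw [hcR]
    have := hR0.card_pos
    positivity
  have hXX : X.card ≤ 2 * (m ^ (2 * (16 * d ^ 2)) * Xs.card) := by
    have := card_pairings_le_card_simplePairings (V := Fin n) (d := d) (by rw [hmA]; exact hm)
    rwa [hmA] at this
  have hX0 : 0 < X.card := hXs0.trans_le (Finset.card_le_card (Finset.filter_subset _ _))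
  have h1 : c * Xs.card ≤ XE.card := by
    rw [hcE, hcR]
    push_cast
    rw [← mul_assoc]
    exact mul_le_mul_of_nonneg_right hE (by positivity)
  -- choose a coloring for each graph and pass to the most frequent statistics
  have hne : Nonempty (Fin n → S) := by
    have hR1 : (0 : ℝ) < R.card := by exact_mod_cast hR0.card_pos
    have hE0 : (0 : ℝ) < E.card := lt_of_lt_of_le (by positivity) hE
    obtain ⟨G, hG⟩ := Finset.card_pos.1 (by exact_mod_cast hE0)
    exact ⟨(hcol G hG).choose⟩
  choose! F hF using hcol
  let ty : Equiv.Perm (Fin n × Fin d) → S × S → ℕ :=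
    fun σ => dartType (F (pairingGraph σ)) (pairingGraph σ)
  have hty : ∀ σ ∈ XE, ty σ = pairType (F (pairingGraph σ) ∘ Prod.fst) σ := fun σ hσ =>
    (pairType_eq_dartType (Finset.mem_filter.1 hσ).1 _).symm
  let t : Finset (S × S → ℕ) := Fintype.piFinset fun _ => Finset.range (m + 1)
  have htc : t.card = (m + 1) ^ (Fintype.card S ^ 2) := by
    simp [t, Fintype.card_piFinset, pow_two]
  have hmaps : ∀ σ ∈ XE, ty σ ∈ t := by
    intro σ hσ
    refine Fintype.mem_piFinset.2 fun k => Finset.mem_range_succ_iff.2 ?_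
    rw [hty σ hσ, ← hmA]
    exact (Finset.card_filter_le _ _).trans_eq Finset.card_univ
  have ht0 : (0 : ℝ) < t.card := by rw [htc]; positivity
  obtain ⟨M, hMt, hM⟩ := Finset.exists_le_card_fiber_of_nsmul_le_card_of_maps_to hmaps
    (Finset.card_pos.1 (by exact_mod_cast ht0)) (b := (XE.card : ℝ) / t.card)
    (by rw [nsmul_eq_mul, mul_div_cancel₀ _ ht0.ne'])
  have hXE0 : (0 : ℝ) < XE.card := lt_of_lt_of_le (by positivity) h1
  obtain ⟨σ₀, hσ₀⟩ : (XE.filter fun σ => ty σ = M).Nonempty := by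
    rw [← Finset.card_pos]
    have : (0 : ℝ) < (XE.filter fun σ => ty σ = M).card := lt_of_lt_of_le (by positivity) hM
    exact_mod_cast this
  rw [Finset.mem_filter] at hσ₀
  have hM𝓜 : M ∈ 𝓜 := hσ₀.2 ▸ hF _ (Finset.mem_filter.1 hσ₀.1).2
  refine ⟨M, hM𝓜, ?_⟩
  -- the color counts are determined by the dart statistics
  let D : S → ℕ := fun s => ∑ t, M (s, t)
  have hcount : ∀ (f : Fin n → S) (σ : Equiv.Perm (Fin n × Fin d)), pairType (f ∘ Prod.fst) σ = M →
      ∀ s, (Finset.univ.filter fun v => f v = s).card * d = D s := by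
    intro f σ h s
    rw [← card_filter_fst_eq, ← sum_pairType_snd (f ∘ Prod.fst) σ, h]
  let f₀ := F (pairingGraph σ₀)
  let N : S → ℕ := fun s => (Finset.univ.filter fun v => f₀ v = s).card
  have hND : ∀ s, N s * d = D s := hcount f₀ σ₀ (by rw [← hty σ₀ hσ₀.1, hσ₀.2])
  have hHN : typeEntropy N n = typeEntropy D m := by
    refine Finset.sum_congr rfl fun s _ => ?_
    rw [← hND s, hmdef]
    push_cast
    rw [mul_div_mul_right _ _ hdR.ne']
  let Q := Finset.univ.filter fun f : Fin n → S =>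
    ∀ s, (Finset.univ.filter fun v => f v = s).card = N s
  have hQ : (Q.card : ℝ) ≤ exp (n * typeEntropy D m) := by
    have := card_filter_type_le (A := Fin n) N
    rw [Fintype.card_fin, hHN] at this
    exact this
  set B := exp (m / 2 * typeEntropy M m +
        (Fintype.card S * (log m + 1) - m * typeEntropy D m)) with hB
  have h2 : ((XE.filter fun σ => ty σ = M).card : ℝ) ≤
      exp (n * typeEntropy D m) * (X.card * B) := by
    have hsub : (XE.filter fun σ => ty σ = M) ⊆
        Q.biUnion fun f => X.filter fun σ => pairType (f ∘ Prod.fst) σ = M := by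
      intro σ hσ
      rw [Finset.mem_filter] at hσ
      have h : pairType (F (pairingGraph σ) ∘ Prod.fst) σ = M := by rw [← hty σ hσ.1, hσ.2]
      refine Finset.mem_biUnion.2 ⟨F (pairingGraph σ), Finset.mem_filter.2 ⟨Finset.mem_univ _,
        fun s => ?_⟩, Finset.mem_filter.2 ⟨?_, h⟩⟩
      · exact Nat.eq_of_mul_eq_mul_right hd ((hcount _ σ h s).trans (hND s).symm)
      · exact Finset.filter_subset _ _ (Finset.filter_subset _ _ hσ.1)
    calc ((XE.filter fun σ => ty σ = M).card : ℝ)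
        ≤ ((∑ f ∈ Q, (X.filter fun σ => pairType (f ∘ Prod.fst) σ = M).card : ℕ) : ℝ) := by
          exact_mod_cast (Finset.card_le_card hsub).trans Finset.card_biUnion_le
      _ = ∑ f ∈ Q, ((X.filter fun σ => pairType (f ∘ Prod.fst) σ = M).card : ℝ) := by
          push_cast; rfl
      _ ≤ ∑ f ∈ Q, X.card * B := by
          refine Finset.sum_le_sum fun f _ => ?_
          have := card_filter_pairings_pairType_le (A := Fin n × Fin d) (f ∘ Prod.fst) M
          rw [hmA] at this
          exact this
      _ = Q.card * (X.card * B) := by rw [Finset.sum_const, nsmul_eq_mul]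
      _ ≤ _ := mul_le_mul_of_nonneg_right hQ (by positivity)
  have h3 : c ≤ 2 * (m : ℝ) ^ (2 * (16 * d ^ 2)) * ((m : ℝ) + 1) ^ (Fintype.card S ^ 2) *
      (exp (n * typeEntropy D m) * B) := by
    have hXs0' : (0 : ℝ) < Xs.card := by exact_mod_cast hXs0
    refine le_of_mul_le_mul_right ?_ hXs0'
    have h4 : (XE.card : ℝ) ≤ t.card * (exp (n * typeEntropy D m) * (X.card * B)) := by
      rw [← div_le_iff₀' ht0]
      exact hM.trans h2
    have h5 : (X.card : ℝ) ≤ 2 * ((m : ℝ) ^ (2 * (16 * d ^ 2)) * Xs.card) := by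
      exact_mod_cast hXX
    calc c * Xs.card ≤ XE.card := h1
      _ ≤ t.card * (exp (n * typeEntropy D m) * (X.card * B)) := h4
      _ ≤ t.card * (exp (n * typeEntropy D m) *
          (2 * ((m : ℝ) ^ (2 * (16 * d ^ 2)) * Xs.card) * B)) := by gcongr
      _ = _ := by rw [htc]; push_cast; ring
  have h6 := log_le_log hc h3
  rw [log_mul (by positivity) (by positivity), log_mul (by positivity) (by positivity),
    log_mul (by positivity) (by positivity), log_pow, log_pow, log_mul (exp_ne_zero _)
    (exp_ne_zero _), log_exp, log_exp] at h6
  have hbethe : n * bethe d (fun k => (M k : ℝ) / m) =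
      n * typeEntropy D m + m / 2 * typeEntropy M m - m * typeEntropy D m := by
    have hD : ∑ s, negMulLog (∑ t, (M (s, t) : ℝ) / m) = typeEntropy D m := by
      refine Finset.sum_congr rfl fun s _ => ?_
      rw [← Finset.sum_div, ← Nat.cast_sum]
    rw [bethe, hD, ← typeEntropy, hmdef]
    push_cast
    ring
  rw [hbethe]
  push_cast at h6 ⊢
  linarith

end FirstMoment

/-! ### Automorphisms of regular trees -/

section TreeAut

variable {V : Type*} {T : SimpleGraph V}

/-- The children of `a` in the tree `T` rooted at `u`. -/
def children (T : SimpleGraph V) (u a : V) : Set V :=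
  {x | T.Adj a x ∧ T.dist u x = T.dist u a + 1}

theorem parent_unique (hT : T.IsTree) {u a b x : V} (ha : x ∈ children T u a)
    (hb : x ∈ children T u b) : a = b := by
  obtain ⟨p, -, hp⟩ := (hT.connected u a).exists_path_of_dist
  obtain ⟨q, -, hq⟩ := (hT.connected u b).exists_path_of_dist
  have h1 : (p.concat ha.1).IsPath :=
    SimpleGraph.Walk.isPath_of_length_eq_dist _ (by
      rw [SimpleGraph.Walk.length_concat, hp, ha.2])
  have h2 : (q.concat hb.1).IsPath :=
    SimpleGraph.Walk.isPath_of_length_eq_dist _ (by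
      rw [SimpleGraph.Walk.length_concat, hq, hb.2])
  have h3 := (hT.existsUnique_path u x).unique h1 h2
  rw [← SimpleGraph.Walk.penultimate_concat p ha.1, h3, SimpleGraph.Walk.penultimate_concat]

theorem exists_parent (hT : T.IsTree) {u x : V} (hx : x ≠ u) : ∃ a, x ∈ children T u a := by
  obtain ⟨p, -, hp⟩ := (hT.connected u x).exists_path_of_dist
  have hnil : ¬ p.Nil := SimpleGraph.Walk.not_nil_of_ne hx.symm
  have hadj := p.adj_penultimate hnil
  refine ⟨p.penultimate, hadj, ?_⟩
  have h1 := SimpleGraph.dist_le p.dropLast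
  have h2 : p.dropLast.length + 1 = p.length := by
    rw [← SimpleGraph.Walk.length_concat _ hadj, SimpleGraph.Walk.concat_dropLast]
  rcases hT.dist_eq_dist_add_one_of_adj u hadj with h | h
  · omega
  · exact h

theorem children_root (u : V) : children T u u = T.neighborSet u := by
  ext x
  refine ⟨fun h => h.1, fun h => ⟨h, ?_⟩⟩
  rw [SimpleGraph.dist_self, SimpleGraph.dist_eq_one_iff_adj.2 h]

theorem ncard_children [T.LocallyFinite] {d : ℕ} (hT : T.IsTree) (hreg : T.IsRegularOfDegree d)
    {u a : V} (ha : a ≠ u) : (children T u a).ncard = d - 1 := by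
  obtain ⟨b, hb⟩ := exists_parent hT ha
  have hn : (T.neighborSet a).ncard = d := by
    rw [← hreg a, ← SimpleGraph.card_neighborSet_eq_degree, Set.ncard_eq_toFinset_card',
      Set.toFinset_card]
  have hset : children T u a = T.neighborSet a \ {b} := by
    ext x
    simp only [Set.mem_sdiff, SimpleGraph.mem_neighborSet, Set.mem_singleton_iff]
    constructor
    · intro h
      refine ⟨h.1, ?_⟩
      rintro rfl
      have := h.2
      have := hb.2
      omega
    · rintro ⟨h1, h2⟩
      refine ⟨h1, ?_⟩
      rcases hT.dist_eq_dist_add_one_of_adj u h1 with h | h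
      · exact absurd (parent_unique hT ⟨h1.symm, h⟩ hb) h2
      · exact h
  rw [hset, Set.ncard_sdiff_singleton_of_mem (show b ∈ T.neighborSet a from hb.1.symm), hn]

/-- A regular tree has an automorphism that fixes a vertex `u` and maps a neighbor `y` of `u` to
another given neighbor `y'`: exchange `y` with `y'` at the root, and below the root match the
`i`-th child of a vertex with the `i`-th child of its image. -/
theorem exists_iso_of_adj [T.LocallyFinite] {d : ℕ} (hT : T.IsTree)
    (hreg : T.IsRegularOfDegree d) {u y y' : V} (hy : T.Adj u y) (hy' : T.Adj u y') :
    ∃ φ : T ≃g T, φ u = u ∧ φ y = y' := by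
  classical
  -- numberings of the children
  have hlab : ∀ a, ∃ l : V → ℕ, a ≠ u → Set.BijOn l (children T u a) (Set.Iio (d - 1)) := by
    intro a
    by_cases ha : a = u
    · exact ⟨fun _ => 0, fun h => absurd ha h⟩
    have hfin : (children T u a).Finite := (Set.toFinite (T.neighborSet a)).subset fun x hx => hx.1
    obtain ⟨l, hl⟩ := hfin.exists_bijOn_of_encard_eq (t := Set.Iio (d - 1)) (by
      rw [← hfin.cast_ncard_eq, ncard_children hT hreg ha, ← (Set.finite_Iio _).cast_ncard_eq]
      simp [Set.ncard_eq_toFinset_card'])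
    exact ⟨l, fun _ => hl⟩
  choose l hl using hlab
  have : Nonempty V := ⟨u⟩
  let e : V → V → V → V := fun a b x =>
    if a = u then Equiv.swap y y' x else Function.invFunOn (l b) (children T u b) (l a x)
  have he : ∀ a b, (a = u ↔ b = u) → ∀ x ∈ children T u a,
      e a b x ∈ children T u b ∧ e b a (e a b x) = x := by
    intro a b hab x hx
    by_cases ha : a = u
    · have hb := hab.1 ha
      subst ha; subst hb
      simp only [e, if_true, Equiv.swap_apply_self, and_true]
      rw [children_root, SimpleGraph.mem_neighborSet] at hx ⊢
      rw [Equiv.swap_apply_def]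
      split_ifs <;> assumption
    · have hb := mt hab.2 ha
      simp only [e, if_neg ha, if_neg hb]
      have hla := hl a ha
      have hlb := hl b hb
      have himg : l a x ∈ l b '' children T u b := by
        rw [hlb.image_eq, ← hla.image_eq]
        exact Set.mem_image_of_mem _ hx
      refine ⟨Function.invFunOn_mem himg, ?_⟩
      rw [Function.invFunOn_eq himg]
      have himg' : l a x ∈ l a '' children T u a := Set.mem_image_of_mem _ hx
      exact hla.injOn (Function.invFunOn_mem himg') hx (Function.invFunOn_eq himg')
  -- recursion on the distance to the root
  have hpar : ∀ x, ∃ a, x ≠ u → x ∈ children T u a := fun x => by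
    by_cases hx : x = u
    · exact ⟨u, fun h => absurd hx h⟩
    · obtain ⟨a, ha⟩ := exists_parent hT hx
      exact ⟨a, fun _ => ha⟩
  choose par hpar using hpar
  have hne : ∀ {a x}, x ∈ children T u a → x ≠ u := by
    rintro a _ hx rfl
    have := hx.2
    simp at this
  obtain ⟨φ, hφu, hφ⟩ : ∃ φ : V → V, φ u = u ∧ ∀ a, ∀ x ∈ children T u a, φ x = e a (φ a) x := by
    let Φ : ℕ → V → V := fun k =>
      Nat.rec (fun _ => u) (fun _ F x => e (par x) (F (par x)) x) k
    refine ⟨fun x => Φ (T.dist u x) x, by simp [Φ], fun a x hx => ?_⟩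
    have hp : par x = a := parent_unique hT (hpar x (hne hx)) hx
    simp only [hx.2]
    change e (par x) (Φ (T.dist u a) (par x)) x = _
    rw [hp]
  have key : ∀ k x, T.dist u x = k → (x = u ↔ φ x = u) ∧ φ (φ x) = x := by
    intro k
    induction k with
    | zero =>
      intro x hx
      have : x = u := ((hT.connected u x).dist_eq_zero_iff.1 hx).symm
      subst this
      simp [hφu]
    | succ k ih =>
      intro x hx
      have hxu : x ≠ u := by rintro rfl; simp at hx
      obtain ⟨a, ha⟩ := exists_parent hT hxu
      obtain ⟨h1, h2⟩ := ih a (by have := ha.2; omega)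
      obtain ⟨h3, h4⟩ := he a (φ a) h1 x ha
      rw [hφ a x ha]
      refine ⟨⟨fun h => absurd h hxu, fun h => absurd h (hne h3)⟩, ?_⟩
      rw [hφ _ _ h3, h2, h4]
  have hinv : Function.Involutive φ := fun x => (key _ x rfl).2
  have hmap : ∀ a, ∀ x ∈ children T u a, φ x ∈ children T u (φ a) := fun a x hx => by
    rw [hφ a x hx]
    exact (he a (φ a) (key _ a rfl).1 x hx).1
  have hadj : ∀ a b, T.Adj a b → T.Adj (φ a) (φ b) := by
    intro a b hab
    rcases hT.dist_eq_dist_add_one_of_adj u hab with h | h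
    · exact (hmap b a ⟨hab.symm, h⟩).1.symm
    · exact (hmap a b ⟨hab, h⟩).1
  refine ⟨⟨hinv.toPerm φ, fun {a b} => ⟨fun h => ?_, fun h => hadj a b h⟩⟩, hφu, ?_⟩
  · have := hadj _ _ h
    simpa [hinv a, hinv b] using this
  · change φ y = y'
    rw [hφ u y ((children_root u).symm ▸ hy), hφu]
    simp [e]

theorem measurableSet_apply_eq_and_apply_eq {S : Type*} [MeasurableSpace S]
    [DiscreteMeasurableSpace S] (u y : V) (s t : S) :
    MeasurableSet {ω : V → S | ω u = s ∧ ω y = t} := by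
  have h1 : MeasurableSet {ω : V → S | ω u = s} :=
    (measurableSet_singleton s).preimage (measurable_pi_apply u)
  have h2 : MeasurableSet {ω : V → S | ω y = t} :=
    (measurableSet_singleton t).preimage (measurable_pi_apply y)
  exact h1.inter h2

/-- An invariant process on a regular tree has the same joint law on all edges at a vertex. -/
theorem IsInvariantProcess.measureReal_edge_eq {S : Type*} [MeasurableSpace S]
    [DiscreteMeasurableSpace S] [T.LocallyFinite] {d : ℕ} (hT : T.IsTree)
    (hreg : T.IsRegularOfDegree d) {ν : Measure (V → S)} (hν : IsInvariantProcess T ν)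
    {u y y' : V} (hy : T.Adj u y) (hy' : T.Adj u y') (s t : S) :
    ν.real {ω | ω u = s ∧ ω y' = t} = ν.real {ω | ω u = s ∧ ω y = t} := by
  obtain ⟨φ, hu, hφy⟩ := exists_iso_of_adj hT hreg hy hy'
  have hu' : φ.symm u = u := by rw [← hu, φ.symm_apply_apply, hu]
  have hy'' : φ.symm y' = y := by rw [← hφy, φ.symm_apply_apply]
  conv_lhs => rw [← hν.map_eq φ]
  rw [map_measureReal_apply (measurable_pi_lambda _ fun v => measurable_pi_apply _)
    (measurableSet_apply_eq_and_apply_eq u y' s t)]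
  simp only [Set.preimage_ofPred_eq, hu', hy'']

end TreeAut

/-! ### Dart statistics under Benjamini-Schramm convergence -/

section LocalLimit

variable {V W X S : Type*} {G : SimpleGraph V} {H : SimpleGraph W} {K : SimpleGraph X}

theorem mem_ball_self (v : V) (r : ℕ) : v ∈ ball G v r := by
  simp [ball]

theorem mem_ball_one {v x : V} : x ∈ ball G v 1 ↔ x = v ∨ G.Adj v x := by
  rw [ball, Set.mem_ofPred_eq, Nat.cast_one]
  constructor
  · intro h
    rcases (Order.le_one_iff).1 h with h | h
    · exact Or.inl (SimpleGraph.edist_eq_zero_iff.1 h).symm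
    · exact Or.inr (SimpleGraph.edist_eq_one_iff_adj.1 h)
  · rintro (rfl | h)
    · simp
    · exact (SimpleGraph.edist_eq_one_iff_adj.2 h).le

theorem BallIso.of_eqOn {f g : V → S} {v : V} {r : ℕ} (h : ∀ x ∈ ball G v r, g x = f x) :
    BallIso G f v G g v r :=
  ⟨SimpleGraph.Iso.refl, fun _ hx => hx, fun x => h x x.2⟩

theorem BallIso.symm {f : V → S} {v : V} {g : W → S} {w : W} {r : ℕ}
    (h : BallIso G f v H g w r) : BallIso H g w G f v r := by
  obtain ⟨e, h1, h2⟩ := h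
  refine ⟨e.symm, fun x hx => ?_, fun x => ?_⟩
  · have : x = e ⟨v, mem_ball_self v r⟩ :=
      Subtype.ext (hx.trans (h1 ⟨v, mem_ball_self v r⟩ rfl).symm)
    rw [this, e.symm_apply_apply]
  · rw [← h2, e.apply_symm_apply]

theorem BallIso.trans {f : V → S} {v : V} {g : W → S} {w : W} {k : X → S} {x : X} {r : ℕ}
    (h : BallIso G f v H g w r) (h' : BallIso H g w K k x r) : BallIso G f v K k x r := by
  obtain ⟨e, h1, h2⟩ := h
  obtain ⟨e', h1', h2'⟩ := h'
  exact ⟨e.trans e', fun y hy => h1' _ (h1 y hy), fun y => (h2' (e y)).trans (h2 y)⟩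

/-- The neighbors of `v` with color `t`. -/
def coloredNeighbors (G : SimpleGraph V) (f : V → S) (v : V) (t : S) : Set V :=
  {x | G.Adj v x ∧ f x = t}

theorem BallIso.color_eq {f : V → S} {v : V} {g : W → S} {w : W} {r : ℕ}
    (h : BallIso G f v H g w r) : f v = g w := by
  obtain ⟨e, h1, h2⟩ := h
  rw [← h1 ⟨v, mem_ball_self v r⟩ rfl, h2]

theorem BallIso.ncard_coloredNeighbors_eq {f : V → S} {v : V} {g : W → S} {w : W}
    (h : BallIso G f v H g w 1) (t : S) :
    (coloredNeighbors G f v t).ncard = (coloredNeighbors H g w t).ncard := by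
  obtain ⟨e, h1, h2⟩ := h
  have hv : (e ⟨v, mem_ball_self v 1⟩ : W) = w := h1 _ rfl
  refine Set.ncard_congr (fun x hx => (e ⟨x, mem_ball_one.2 (Or.inr hx.1)⟩ : W)) ?_ ?_ ?_
  · intro x hx
    refine ⟨?_, (h2 _).trans hx.2⟩
    have : (G.induce (ball G v 1)).Adj ⟨v, mem_ball_self v 1⟩ ⟨x, mem_ball_one.2 (Or.inr hx.1)⟩ :=
      hx.1
    have h3 : H.Adj (e ⟨v, mem_ball_self v 1⟩ : W) (e ⟨x, mem_ball_one.2 (Or.inr hx.1)⟩ : W) :=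
      e.map_rel_iff.2 this
    rw [hv] at h3
    exact h3
  · intro x y hx hy hxy
    exact congrArg Subtype.val (e.injective (Subtype.ext hxy))
  · intro y hy
    have hyb : y ∈ ball H w 1 := mem_ball_one.2 (Or.inr hy.1)
    obtain ⟨x, hx⟩ := e.surjective ⟨y, hyb⟩
    have hadj : G.Adj v x := by
      have h3 : (H.induce (ball H w 1)).Adj (e ⟨v, mem_ball_self v 1⟩) (e x) := by
        rw [hx, SimpleGraph.comap_adj]
        change H.Adj (e ⟨v, mem_ball_self v 1⟩ : W) y
        rw [hv]
        exact hy.1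
      exact e.map_rel_iff.1 h3
    refine ⟨x, ⟨hadj, ?_⟩, ?_⟩
    · rw [← h2, hx]; exact hy.2
    · simp [hx]

variable {T : SimpleGraph V}

/-- Two colorings are equivalent if they agree on the `1`-neighborhood of `o` up to a rooted
isomorphism. -/
def ballSetoid (S : Type*) (T : SimpleGraph V) (o : V) : Setoid (V → S) where
  r ω ω' := BallIso T ω o T ω' o 1
  iseqv := ⟨fun _ => BallIso.of_eqOn fun _ _ => rfl, BallIso.symm, BallIso.trans⟩

theorem finite_ball_one [T.LocallyFinite] (o : V) : (ball T o 1).Finite := by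
  refine ((Set.toFinite (T.neighborSet o)).insert o).subset fun x hx => ?_
  exact (mem_ball_one.1 hx)

open scoped Classical in
/-- A coloring of the ball, extended by the color of its center; the values outside of the ball do
not matter. -/
noncomputable def extendBall (T : SimpleGraph V) (o : V) (c : ball T o 1 → S) : V → S :=
  fun x => if h : x ∈ ball T o 1 then c ⟨x, h⟩ else c ⟨o, mem_ball_self o 1⟩

theorem ballIso_extendBall (o : V) (ω : V → S) :
    BallIso T ω o T (extendBall T o fun x => ω x) o 1 :=
  BallIso.of_eqOn fun x hx => by simp [extendBall, hx]

theorem finite_quotient_ballSetoid [T.LocallyFinite] [Finite S] (o : V) :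
    Finite (Quotient (ballSetoid S T o)) := by
  have := (finite_ball_one (T := T) o).to_subtype
  refine Finite.of_surjective (fun c : ball T o 1 → S => (⟦extendBall T o c⟧ : Quotient _)) ?_
  intro q
  induction q using Quotient.inductionOn with
  | h ω => exact ⟨fun x => ω x, Quotient.sound (ballIso_extendBall o ω).symm⟩

theorem measurableSet_ballIso [T.LocallyFinite] [Finite S] [MeasurableSpace S]
    [DiscreteMeasurableSpace S] (o : V) (g : V → S) :
    MeasurableSet {ω | BallIso T ω o T g o 1} := by
  have := (finite_ball_one (T := T) o).to_subtype
  have h : {ω : V → S | BallIso T ω o T g o 1} =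
      (fun ω : V → S => fun x : ball T o 1 => ω x) ⁻¹'
        {c | BallIso T (extendBall T o c) o T g o 1} := by
    ext ω
    exact ⟨fun h => (ballIso_extendBall o ω).symm.trans h,
      fun h => (ballIso_extendBall o ω).trans h⟩
  rw [h]
  exact (measurable_pi_lambda _ fun x => measurable_pi_apply _) (Set.toFinite _).measurableSet

open scoped Classical in
/-- The number of darts with colors `(s, t)` at the vertex `v`. -/
noncomputable def localDarts (G : SimpleGraph V) (f : V → S) (v : V) (s t : S) : ℝ :=
  if f v = s then ((coloredNeighbors G f v t).ncard : ℝ) else 0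

theorem BallIso.localDarts_eq {f : V → S} {v : V} {g : W → S} {w : W}
    (h : BallIso G f v H g w 1) (s t : S) : localDarts G f v s t = localDarts H g w s t := by
  rw [localDarts, localDarts, h.color_eq, h.ncard_coloredNeighbors_eq]

theorem sum_localDarts {V : Type*} [Fintype V] [Fintype S] [DecidableEq S] (G : SimpleGraph V)
    (f : V → S) (s t : S) : ∑ v, localDarts G f v s t = dartType f G (s, t) := by
  classical
  rw [dartType, Finset.card_eq_sum_card_fiberwise (f := Prod.fst) (t := Finset.univ)
    (fun _ _ => Finset.mem_coe.2 (Finset.mem_univ _)), Nat.cast_sum]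
  refine Finset.sum_congr rfl fun v _ => ?_
  rw [localDarts]
  split_ifs with h
  · congr 1
    rw [← Set.ncard_coe_finset]
    refine Set.ncard_congr (fun x _ => (v, x)) ?_ (by simp) ?_
    · intro x hx
      simpa [h, coloredNeighbors] using hx
    · rintro ⟨a, x⟩ hx
      simp only [Finset.coe_filter, Finset.mem_filter, Finset.mem_univ, true_and,
        Set.mem_ofPred_eq, Prod.mk.injEq] at hx
      obtain ⟨⟨h1, -, h2⟩, rfl⟩ := hx
      exact ⟨x, ⟨h1, h2⟩, rfl⟩
  · symm
    rw [Nat.cast_eq_zero, Finset.card_eq_zero, Finset.eq_empty_iff_forall_notMem]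
    rintro ⟨a, x⟩ hx
    simp only [Finset.mem_filter, Finset.mem_univ, true_and, Prod.mk.injEq] at hx
    obtain ⟨⟨h1, h3, h2⟩, rfl⟩ := hx
    exact h h3

theorem localDarts_nonneg (f : V → S) (v : V) (s t : S) : 0 ≤ localDarts G f v s t := by
  rw [localDarts]; split_ifs <;> positivity

theorem localDarts_le {n d : ℕ} {G : SimpleGraph (Fin n)} (hG : G ∈ regularGraphs d n)
    (f : Fin n → S) (v : Fin n) (s t : S) : localDarts G f v s t ≤ d := by
  rw [localDarts]
  split_ifs
  · rw [← mem_regularGraphs_iff.1 hG v, Nat.card_coe_set_eq]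
    exact_mod_cast Set.ncard_le_ncard (fun x (hx : x ∈ coloredNeighbors G f v t) => hx.1)
      (Set.toFinite _)
  · positivity

/-- The mean of a function of the colored `1`-neighborhood of `o`, as a sum over isomorphism
classes. -/
theorem sum_mul_measureReal_ballIso [T.LocallyFinite] [Finite S] [MeasurableSpace S]
    [DiscreteMeasurableSpace S] (ν : Measure (V → S)) [IsProbabilityMeasure ν] (o : V)
    [Fintype (Quotient (ballSetoid S T o))] (F : (V → S) → ℝ)
    (hF : ∀ ω ω', BallIso T ω o T ω' o 1 → F ω = F ω') :
    ∑ q : Quotient (ballSetoid S T o), F q.out * ν.real {ω | BallIso T ω o T q.out o 1} =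
      ∫ ω, F ω ∂ν := by
  classical
  have hpt : ∀ ω, F ω = ∑ q : Quotient (ballSetoid S T o),
      Set.indicator {ω | BallIso T ω o T q.out o 1} (fun _ => F q.out) ω := by
    intro ω
    have h0 : BallIso T ω o T (Quotient.out (⟦ω⟧ : Quotient (ballSetoid S T o))) o 1 :=
      (Quotient.mk_out (s := ballSetoid S T o) ω : BallIso _ _ _ _ _ _ _).symm
    rw [Finset.sum_eq_single (⟦ω⟧ : Quotient (ballSetoid S T o))]
    · rw [Set.indicator_of_mem (show ω ∈ {ω | BallIso T ω o T _ o 1} from h0)]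
      exact hF _ _ h0
    · intro q _ hq
      refine Set.indicator_of_notMem (fun h => hq ?_) _
      rw [← Quotient.out_eq q]
      exact Quotient.sound (show BallIso T q.out o T ω o 1 from BallIso.symm h)
    · simp
  rw [integral_congr_ae (ae_of_all _ hpt), integral_finsetSum]
  · refine Finset.sum_congr rfl fun q _ => ?_
    rw [integral_indicator_const _ (measurableSet_ballIso o _), smul_eq_mul, mul_comm]
  · exact fun q _ => (integrable_const _).indicator (measurableSet_ballIso o _)

theorem integral_localDarts [T.LocallyFinite] [MeasurableSpace S]
    [DiscreteMeasurableSpace S] (ν : Measure (V → S)) [IsProbabilityMeasure ν] (o : V) (s t : S) :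
    ∫ ω, localDarts T ω o s t ∂ν =
      ∑ y ∈ T.neighborFinset o, ν.real {ω | ω o = s ∧ ω y = t} := by
  classical
  have hm := fun y => measurableSet_apply_eq_and_apply_eq o y s t
  have hpt : ∀ ω : V → S, localDarts T ω o s t =
      ∑ y ∈ T.neighborFinset o, Set.indicator {ω | ω o = s ∧ ω y = t} (fun _ => (1 : ℝ)) ω := by
    intro ω
    simp only [Set.indicator_apply, Set.mem_ofPred_eq]
    rw [Finset.sum_boole, localDarts]
    split_ifs with h
    · rw [← Set.ncard_coe_finset]
      congr 2
      ext y
      simp [coloredNeighbors, h]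
    · simp [h]
  rw [integral_congr_ae (ae_of_all _ hpt), integral_finsetSum]
  · refine Finset.sum_congr rfl fun q _ => ?_
    rw [integral_indicator_const _ (hm q), smul_eq_mul, mul_one]
  · exact fun q _ => (integrable_const _).indicator (hm q)

/-- Under Benjamini-Schramm convergence, the dart statistics converge to the law of the colors at
the root and at a random neighbor of it. -/
theorem BSConverges.tendsto_dartType [T.LocallyFinite] [Fintype S] [DecidableEq S]
    [MeasurableSpace S] [DiscreteMeasurableSpace S] {ν : Measure (V → S)} [IsProbabilityMeasure ν]
    {d : ℕ} {n : ℕ → ℕ} {G : ∀ i, SimpleGraph (Fin (n i))}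
    (hG : ∀ i, G i ∈ regularGraphs d (n i)) {f : ∀ i, Fin (n i) → S}
    (h : BSConverges G f T ν) (o : V) (s t : S) :
    Tendsto (fun i => (dartType (f i) (G i) (s, t) : ℝ) / n i) atTop
      (𝓝 (∑ y ∈ T.neighborFinset o, ν.real {ω | ω o = s ∧ ω y = t})) := by
  classical
  have := finite_quotient_ballSetoid (S := S) (T := T) o
  have := Fintype.ofFinite (Quotient (ballSetoid S T o))
  let F : Quotient (ballSetoid S T o) → ℝ := fun q => localDarts T q.out o s t
  let A : ∀ i, Quotient (ballSetoid S T o) → Set (Fin (n i)) :=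
    fun i q => {v | BallIso (G i) (f i) v T q.out o 1}
  have hA : ∀ q, Tendsto (fun i => vertexProb (A i q)) atTop
      (𝓝 (ν.real {ω | BallIso T ω o T q.out o 1})) := fun q => h o 1 q.out
  have hlow : Tendsto (fun i => ∑ q, F q * vertexProb (A i q)) atTop
      (𝓝 (∑ y ∈ T.neighborFinset o, ν.real {ω | ω o = s ∧ ω y = t})) := by
    rw [← integral_localDarts, ← sum_mul_measureReal_ballIso (T := T) ν o
      (fun ω => localDarts T ω o s t) fun ω ω' h => h.localDarts_eq s t]
    exact tendsto_finsetSum _ fun q _ => (hA q).const_mul _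
  have herr : Tendsto (fun i => (d : ℝ) * (1 - ∑ q, vertexProb (A i q))) atTop (𝓝 0) := by
    have h1 := sum_mul_measureReal_ballIso (T := T) ν o (fun _ => (1 : ℝ)) fun _ _ _ => rfl
    simp only [one_mul, integral_const, probReal_univ, smul_eq_mul] at h1
    have h2 := ((tendsto_finsetSum Finset.univ fun q _ => hA q).const_sub 1).const_mul (d : ℝ)
    rwa [h1, sub_self, mul_zero] at h2
  have hup := hlow.add herr
  rw [add_zero] at hup
  -- each vertex is in at most one of the sets `A i q`
  have hpt : ∀ i v, ∑ q, F q * (A i q).indicator 1 v ≤ localDarts (G i) (f i) v s t ∧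
      localDarts (G i) (f i) v s t ≤ ∑ q, F q * (A i q).indicator 1 v +
        d * (1 - ∑ q, (A i q).indicator (1 : Fin (n i) → ℝ) v) := by
    intro i v
    by_cases hv : ∃ q, v ∈ A i q
    · obtain ⟨q, hq⟩ := hv
      have hother : ∀ q', q' ≠ q → v ∉ A i q' := by
        intro q' hne hq'
        refine hne ?_
        rw [← Quotient.out_eq q, ← Quotient.out_eq q']
        exact Quotient.sound (show BallIso T q'.out o T q.out o 1 from
          (BallIso.symm hq').trans hq)
      have h1 : ∑ q', F q' * (A i q').indicator 1 v = F q := by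
        rw [Finset.sum_eq_single q (fun q' _ hne => by
          rw [Set.indicator_of_notMem (hother q' hne), mul_zero]) (by simp)]
        rw [Set.indicator_of_mem hq]; simp
      have h2 : ∑ q', (A i q').indicator (1 : Fin (n i) → ℝ) v = 1 := by
        rw [Finset.sum_eq_single q (fun q' _ hne => by
          rw [Set.indicator_of_notMem (hother q' hne)]) (by simp)]
        rw [Set.indicator_of_mem hq]; simp
      have h3 : localDarts (G i) (f i) v s t = F q := BallIso.localDarts_eq hq s t
      rw [h1, h2, h3]
      simp
    · push Not at hv
      have h1 : ∀ q, (A i q).indicator (1 : Fin (n i) → ℝ) v = 0 := fun q =>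
        Set.indicator_of_notMem (hv q) _
      simp only [h1, mul_zero, Finset.sum_const_zero, sub_zero, mul_one, zero_add]
      exact ⟨localDarts_nonneg _ _ _ _, localDarts_le (hG i) _ _ _ _⟩
  have hind : ∀ i q, ∑ v, (A i q).indicator (1 : Fin (n i) → ℝ) v = (A i q).ncard := by
    intro i q
    rw [Set.ncard_eq_toFinset_card']
    simp only [Set.indicator_apply, Pi.one_apply]
    rw [Finset.sum_boole]
    congr 2
    ext v
    simp
  have hbound : ∀ i, ∑ q, F q * vertexProb (A i q) ≤ (dartType (f i) (G i) (s, t) : ℝ) / n i ∧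
      (dartType (f i) (G i) (s, t) : ℝ) / n i ≤ ∑ q, F q * vertexProb (A i q) +
        d * (1 - ∑ q, vertexProb (A i q)) := by
    intro i
    rw [← sum_localDarts]
    rcases Nat.eq_zero_or_pos (n i) with h0 | h0
    · -- all quotients by `n i` are zero
      simp [vertexProb, h0]
    have hpos : (0 : ℝ) < n i := by exact_mod_cast h0
    have e1 : ∑ q, F q * vertexProb (A i q) =
        (∑ v, ∑ q, F q * (A i q).indicator 1 v) / n i := by
      rw [Finset.sum_comm, Finset.sum_div]
      refine Finset.sum_congr rfl fun q _ => ?_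
      rw [← Finset.mul_sum, hind, vertexProb, mul_div_assoc]
    have e2 : d * (1 - ∑ q, vertexProb (A i q)) =
        (∑ v, d * (1 - ∑ q, (A i q).indicator (1 : Fin (n i) → ℝ) v)) / n i := by
      rw [← Finset.mul_sum, Finset.sum_sub_distrib, Finset.sum_comm]
      simp only [hind, vertexProb]
      rw [← Finset.sum_div]
      simp
      field_simp
    rw [e1, e2, ← add_div, ← Finset.sum_add_distrib]
    exact ⟨div_le_div_of_nonneg_right (Finset.sum_le_sum fun v _ => (hpt i v).1) hpos.le,
      div_le_div_of_nonneg_right (Finset.sum_le_sum fun v _ => (hpt i v).2) hpos.le⟩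
  exact tendsto_of_tendsto_of_tendsto_of_le_of_le hlow hup (fun i => (hbound i).1)
    fun i => (hbound i).2

end LocalLimit

/-! ### Large girth forces large size -/

section Girth

theorem exists_isCycle_length_le {n d : ℕ} (hn : 0 < n) (hd : 2 ≤ d) {G : SimpleGraph (Fin n)}
    (hG : G ∈ regularGraphs d n) : ∃ (v : Fin n) (c : G.Walk v v), c.IsCycle ∧ c.length ≤ n := by
  classical
  have : Nonempty (Fin n) := ⟨⟨0, hn⟩⟩
  have hcyc : ¬ G.IsAcyclic := by
    -- otherwise an end point of a longest path is a leaf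
    intro hac
    obtain ⟨u, v, p, hp, hmax⟩ := SimpleGraph.Walk.exists_isPath_forall_isPath_length_le_length G
    have hsub : G.neighborSet u ⊆ {p.snd} := by
      intro w hadj
      rw [SimpleGraph.mem_neighborSet] at hadj
      refine hac.eq_snd_of_adj_start hp hadj ?_
      by_contra hw
      have h1 := hmax _ _ _ (hp.cons (h := hadj.symm) hw)
      rw [SimpleGraph.Walk.length_cons] at h1
      omega
    have h1 := Set.ncard_le_ncard hsub (Set.finite_singleton _)
    rw [Set.ncard_singleton, ← Nat.card_coe_set_eq, mem_regularGraphs_iff.1 hG u] at h1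
    omega
  rw [SimpleGraph.IsAcyclic] at hcyc
  push Not at hcyc
  obtain ⟨v, c, hc⟩ := hcyc
  refine ⟨v, c, hc, ?_⟩
  have h1 := hc.support_nodup.length_le_card
  rw [Fintype.card_fin, List.length_tail, SimpleGraph.Walk.length_support] at h1
  simpa using h1

theorem IsLargeGirth.tendsto_card {d : ℕ} (hd : 2 ≤ d) {n : ℕ → ℕ}
    {G : ∀ i, SimpleGraph (Fin (n i))} (hG : ∀ i, G i ∈ regularGraphs d (n i))
    (h : IsLargeGirth G) (hn : ∀ᶠ i in atTop, 0 < n i) : Tendsto n atTop atTop := by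
  refine tendsto_atTop.2 fun N => ?_
  obtain ⟨k, hk⟩ := h (1 / (N + 1)) (by positivity)
  filter_upwards [hn, eventually_ge_atTop k] with i hi hki
  by_contra! hlt
  obtain ⟨v, c, hc, hlen⟩ := exists_isCycle_length_le hi hd (hG i)
  have h1 := hk i hki
  have hpos : (0 : ℝ) < n i := by exact_mod_cast hi
  have hceil : n i ≤ ⌈(1 : ℝ) / (1 / (N + 1))⌉₊ := by
    rw [one_div_one_div]
    refine (Nat.cast_le (α := ℝ)).1 (le_trans ?_ (Nat.le_ceil _))
    have : (n i : ℝ) ≤ N := by exact_mod_cast hlt.le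
    linarith
  have h2 : (1 : ℝ) / n i ≤ vertexProb {v | ∃ c : (G i).Walk v v, c.IsCycle ∧
      c.length ≤ ⌈(1 : ℝ) / (1 / (N + 1))⌉₊} := by
    refine div_le_div_of_nonneg_right ?_ hpos.le
    have : 0 < Set.ncard {v | ∃ c : (G i).Walk v v, c.IsCycle ∧
      c.length ≤ ⌈(1 : ℝ) / (1 / (N + 1))⌉₊} :=
      (Set.ncard_pos (Set.toFinite _)).2 ⟨v, c, hc, hlen.trans hceil⟩
    exact_mod_cast this
  have h3 := (one_div_le_one_div hpos (by positivity)).1 (h2.trans h1)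
  have : (n i : ℝ) < N := by exact_mod_cast hlt
  linarith

end Girth

/-! ### Random regular graphs -/

section Random

theorem randomRegularSeq_apply {d : ℕ} {n : ℕ → ℕ} (hn : ∀ i, (regularGraphs d (n i)).Nonempty)
    (i : ℕ) (A : Set (SimpleGraph (Fin (n i)))) :
    randomRegularSeq d n hn {G | G i ∈ A} = randomRegularGraph d (n i) A := by
  have := fun i => isProbabilityMeasure_randomRegularGraph (hn i)
  rw [← Measure.infinitePi_map_eval (fun i => randomRegularGraph d (n i)) i,
    Measure.map_apply (measurable_pi_apply i) A.toFinite.measurableSet]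
  rfl

theorem ae_mem_regularGraphs {d : ℕ} {n : ℕ → ℕ} (hn : ∀ i, (regularGraphs d (n i)).Nonempty) :
    ∀ᵐ G ∂(randomRegularSeq d n hn), ∀ i, G i ∈ regularGraphs d (n i) := by
  rw [ae_all_iff]
  intro i
  rw [ae_iff]
  have h := randomRegularSeq_apply hn i (regularGraphs d (n i))ᶜ
  rw [randomRegularGraph, (uniformOn_eq_zero_iff (Set.toFinite _)).2 (Set.inter_compl_self _)] at h
  exact h

/-- If almost every sequence is eventually in the events `E i`, then for some `c > 0` the event
`E i` contains at least a fraction `c` of the regular graphs for all large `i`. -/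
theorem exists_mul_card_le {d : ℕ} {n : ℕ → ℕ} (hn : ∀ i, (regularGraphs d (n i)).Nonempty)
    (E R : ∀ i, Finset (SimpleGraph (Fin (n i))))
    (hR : ∀ i, (R i : Set (SimpleGraph (Fin (n i)))) = regularGraphs d (n i))
    (hER : ∀ i, E i ⊆ R i)
    (h : ∀ᵐ G ∂(randomRegularSeq d n hn), ∃ N, ∀ i ≥ N, G i ∈ E i) :
    ∃ c : ℝ, 0 < c ∧ ∃ N, ∀ i ≥ N, c * (R i).card ≤ (E i).card := by
  classical
  have hprob : ∀ i, IsProbabilityMeasure (randomRegularGraph d (n i)) :=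
    fun i => isProbabilityMeasure_randomRegularGraph (hn i)
  have hprobP : IsProbabilityMeasure (randomRegularSeq d n hn) := by
    rw [randomRegularSeq]; infer_instance
  obtain ⟨N, hN⟩ : ∃ N, randomRegularSeq d n hn {G | ∀ i ≥ N, G i ∈ E i} ≠ 0 := by
    by_contra! h0
    have h1 : randomRegularSeq d n hn (⋃ N, {G | ∀ i ≥ N, G i ∈ E i}) = 0 :=
      measure_iUnion_null h0
    have h2 : ∀ᵐ G ∂(randomRegularSeq d n hn), G ∈ ⋃ N, {G | ∀ i ≥ N, G i ∈ E i} := by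
      filter_upwards [h] with G hG
      simpa using hG
    obtain ⟨G, hG, hG'⟩ := (h2.and (measure_eq_zero_iff_ae_notMem.1 h1)).exists
    exact hG' hG
  refine ⟨(randomRegularSeq d n hn {G | ∀ i ≥ N, G i ∈ E i}).toReal,
    ENNReal.toReal_pos hN (measure_ne_top _ _), N, fun i hi => ?_⟩
  have h1 : randomRegularSeq d n hn {G | ∀ i ≥ N, G i ∈ E i} ≤ (E i).card / (R i).card := by
    calc _ ≤ randomRegularSeq d n hn {G | G i ∈ (E i : Set (SimpleGraph (Fin (n i))))} :=
          measure_mono fun G (hG : ∀ i ≥ N, G i ∈ E i) => hG i hi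
      _ = _ := by
          rw [randomRegularSeq_apply, randomRegularGraph, ← hR, uniformOn_apply_finset,
            Finset.inter_eq_right.2 (hER i)]
  have hR0 : 0 < (R i).card := by
    rw [Finset.card_pos, ← Finset.coe_nonempty, hR]
    exact hn i
  have h2 := ENNReal.toReal_mono (ENNReal.div_ne_top (by simp) (by exact_mod_cast hR0.ne')) h1
  rw [ENNReal.toReal_div] at h2
  simp only [ENNReal.toReal_natCast] at h2
  rwa [le_div_iff₀ (by exact_mod_cast hR0)] at h2

end Random

/-! ### The entropy inequality -/

section Main

open Real

variable {V S : Type*} [Fintype S] [MeasurableSpace S] [DiscreteMeasurableSpace S]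

theorem sum_measureReal_edge (ν : Measure (V → S)) [IsProbabilityMeasure ν] (u v : V) (s : S) :
    ∑ t, ν.real {ω | ω u = s ∧ ω v = t} = ν.real {ω | ω u = s} := by
  rw [← measureReal_biUnion_finset]
  · congr 1
    ext ω
    simp
  · intro t _ t' _ htt
    refine Set.disjoint_left.2 fun ω h h' => htt ?_
    exact h.2.symm.trans h'.2
  · exact fun t _ => measurableSet_apply_eq_and_apply_eq u v s t

theorem configEntropy_eq_sum [DecidableEq V] (ν : Measure (V → S)) (F : Finset V) :
    configEntropy ν F = ∑ a : F → S, negMulLog (ν.real {ω | ∀ x : F, ω x = a x}) := by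
  classical
  refine Finset.sum_congr rfl fun a _ => ?_
  rw [map_measureReal_apply (measurable_pi_lambda _ fun x => measurable_pi_apply _)
    (measurableSet_singleton a), negMulLog, neg_mul]
  congr 4 <;> · ext ω; simp [funext_iff]

theorem configEntropy_pair [DecidableEq V] (ν : Measure (V → S)) {u v : V} (huv : u ≠ v) :
    configEntropy ν {u, v} =
      ∑ k : S × S, negMulLog (ν.real {ω | ω u = k.1 ∧ ω v = k.2}) := by
  classical
  rw [configEntropy_eq_sum]
  let e : ((({u, v} : Finset V) → S)) ≃ S × S :=
    { toFun := fun a => (a ⟨u, by simp⟩, a ⟨v, by simp⟩)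
      invFun := fun k x => if (x : V) = u then k.1 else k.2
      left_inv := by
        intro a
        ext ⟨x, hx⟩
        by_cases h : x = u
        · subst h; simp
        · have : x = v := by simpa [h] using hx
          subst this
          simp [h]
      right_inv := by
        rintro ⟨s, t⟩
        simp [huv.symm] }
  refine Fintype.sum_equiv e _ _ fun a => ?_
  congr 2
  ext ω
  exact ⟨fun h => ⟨h ⟨u, by simp⟩, h ⟨v, by simp⟩⟩, fun h => by
    rintro ⟨x, hx⟩
    rcases Finset.mem_insert.1 hx with rfl | hx'
    · exact h.1
    · obtain rfl := Finset.mem_singleton.1 hx'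
      exact h.2⟩

theorem configEntropy_singleton [DecidableEq V] (ν : Measure (V → S)) (w : V) :
    configEntropy ν {w} = ∑ s, negMulLog (ν.real {ω | ω w = s}) := by
  classical
  rw [configEntropy_eq_sum]
  let e : ((({w} : Finset V) → S)) ≃ S :=
    { toFun := fun a => a ⟨w, by simp⟩
      invFun := fun s _ => s
      left_inv := by
        intro a
        ext ⟨x, hx⟩
        obtain rfl : x = w := by simpa using hx
        rfl
      right_inv := fun _ => rfl }
  refine Fintype.sum_equiv e _ _ fun a => ?_
  congr 2
  ext ω
  exact ⟨fun h => h ⟨w, by simp⟩, fun h => by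
    rintro ⟨x, hx⟩
    obtain rfl := Finset.mem_singleton.1 hx
    exact h⟩

variable {T : SimpleGraph V} [T.LocallyFinite] {d : ℕ} {ν : Measure (V → S)}

/-- The law of a coloring limit at a vertex does not depend on the vertex. -/
theorem BSConverges.measureReal_vertex_eq (hd : 0 < d) (hreg : T.IsRegularOfDegree d)
    [IsProbabilityMeasure ν] {n : ℕ → ℕ} {G : ∀ i, SimpleGraph (Fin (n i))}
    (hG : ∀ i, G i ∈ regularGraphs d (n i)) {f : ∀ i, Fin (n i) → S}
    (h : BSConverges G f T ν) (u w : V) (s : S) :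
    ν.real {ω | ω u = s} = ν.real {ω | ω w = s} := by
  classical
  have hlaw : ∀ o : V, ∑ t, ∑ y ∈ T.neighborFinset o, ν.real {ω | ω o = s ∧ ω y = t} =
      d * ν.real {ω | ω o = s} := by
    intro o
    rw [Finset.sum_comm]
    simp only [sum_measureReal_edge]
    rw [Finset.sum_const, nsmul_eq_mul, SimpleGraph.card_neighborFinset_eq_degree, hreg o]
  have h1 : ∑ t, ∑ y ∈ T.neighborFinset u, ν.real {ω | ω u = s ∧ ω y = t} =
      ∑ t, ∑ y ∈ T.neighborFinset w, ν.real {ω | ω w = s ∧ ω y = t} :=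
    Finset.sum_congr rfl fun t _ => tendsto_nhds_unique (h.tendsto_dartType hG u s t)
      (h.tendsto_dartType hG w s t)
  rw [hlaw, hlaw] at h1
  exact mul_left_cancel₀ (by positivity) h1

/-- The dart frequencies converge to the law of the colors on an edge. -/
theorem BSConverges.tendsto_dartType_div [DecidableEq S] (hd : 0 < d) (hT : T.IsTree)
    (hreg : T.IsRegularOfDegree d) (hν : IsInvariantProcess T ν) {n : ℕ → ℕ}
    {G : ∀ i, SimpleGraph (Fin (n i))} (hG : ∀ i, G i ∈ regularGraphs d (n i))
    {f : ∀ i, Fin (n i) → S} (h : BSConverges G f T ν) {u v : V} (huv : T.Adj u v) (k : S × S) :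
    Tendsto (fun i => (dartType (f i) (G i) k : ℝ) / (n i * d : ℕ)) atTop
      (𝓝 (ν.real {ω | ω u = k.1 ∧ ω v = k.2})) := by
  have := hν.isProbabilityMeasure
  have h1 := (h.tendsto_dartType hG u k.1 k.2).div_const (d : ℝ)
  rw [Finset.sum_congr rfl fun y hy => hν.measureReal_edge_eq hT hreg huv
    ((SimpleGraph.mem_neighborFinset _ _ _).1 hy) k.1 k.2, Finset.sum_const,
    SimpleGraph.card_neighborFinset_eq_degree, hreg u, nsmul_eq_mul,
    mul_div_cancel_left₀ _ (by positivity)] at h1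
  refine h1.congr fun i => ?_
  rw [div_div]
  push_cast
  rfl

theorem BSConverges.eventually_pos [IsProbabilityMeasure ν] {n : ℕ → ℕ}
    {G : ∀ i, SimpleGraph (Fin (n i))} {f : ∀ i, Fin (n i) → S}
    (hd : 0 < d) (hT : T.IsTree)
    (hreg : T.IsRegularOfDegree d) (hν : IsInvariantProcess T ν)
    (hG : ∀ i, G i ∈ regularGraphs d (n i)) (h : BSConverges G f T ν) {u v : V}
    (huv : T.Adj u v) : ∀ᶠ i in atTop, 0 < n i := by
  classical
  have h1 := tendsto_finsetSum Finset.univ fun k (_ : k ∈ Finset.univ) =>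
    h.tendsto_dartType_div hd hT hreg hν hG huv k
  have h2 : ∑ k : S × S, ν.real {ω | ω u = k.1 ∧ ω v = k.2} = 1 := by
    rw [Fintype.sum_prod_type]
    simp only [sum_measureReal_edge]
    have := sum_measureReal_preimage_singleton (μ := ν) Finset.univ (f := fun ω : V → S => ω u)
      fun s _ => (measurableSet_singleton s).preimage (measurable_pi_apply u)
    rw [Finset.coe_univ, Set.preimage_univ, probReal_univ] at this
    exact this
  rw [h2] at h1
  filter_upwards [h1.eventually (lt_mem_nhds zero_lt_one)] with i hi
  by_contra h0
  have : n i = 0 := by omega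
  simp [this] at hi

theorem continuous_bethe {S : Type*} [Fintype S] (d : ℕ) :
    Continuous (bethe d : (S × S → ℝ) → ℝ) := by
  unfold bethe
  fun_prop

/-- The error term of the first moment bound is negligible. -/
theorem tendsto_error_div {n : ℕ → ℕ} (hn : Tendsto n atTop atTop) (d : ℕ) (a b c : ℝ) :
    Tendsto (fun i => (c - a * log (n i * d : ℕ) - b * log ((n i * d : ℕ) + 1)) / n i) atTop
      (𝓝 0) := by
  have hcast : Tendsto (fun i => (n i : ℝ)) atTop atTop := tendsto_natCast_atTop_atTop.comp hn
  have hlog : Tendsto (fun i => (log (n i : ℝ)) / n i) atTop (𝓝 0) :=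
    (isLittleO_log_id_atTop.tendsto_div_nhds_zero).comp hcast
  have hinv : Tendsto (fun i => ((n i : ℝ))⁻¹) atTop (𝓝 0) := tendsto_inv_atTop_zero.comp hcast
  have hmul : ∀ g : ℕ → ℝ, (∀ᶠ i in atTop, 0 ≤ g i ∧ g i ≤ log (n i) + log (d + 1)) →
      Tendsto (fun i => g i / n i) atTop (𝓝 0) := by
    intro g hg
    have hup : Tendsto (fun i => log (n i : ℝ) / n i + log (d + 1) * (n i : ℝ)⁻¹) atTop (𝓝 0) := by
      simpa using hlog.add (hinv.const_mul (log ((d : ℝ) + 1)))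
    refine tendsto_of_tendsto_of_tendsto_of_le_of_le' tendsto_const_nhds hup ?_ ?_
    · filter_upwards [hg] with i hi
      exact div_nonneg hi.1 (by positivity)
    · filter_upwards [hg] with i hi
      rw [← div_eq_mul_inv, ← add_div]
      exact div_le_div_of_nonneg_right hi.2 (by positivity)
  have hle : ∀ᶠ i in atTop, log ((n i * d : ℕ) + 1 : ℝ) ≤ log (n i) + log (d + 1) := by
    filter_upwards [hn.eventually_ge_atTop 1] with i hi
    have h1 : (1 : ℝ) ≤ n i := by exact_mod_cast hi
    rw [← log_mul (by positivity) (by positivity)]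
    refine log_le_log (by positivity) ?_
    push_cast
    nlinarith
  have hA := hmul (fun i => log (n i * d : ℕ)) (by
    filter_upwards [hle] with i hi
    refine ⟨log_natCast_nonneg _, le_trans ?_ hi⟩
    rcases Nat.eq_zero_or_pos (n i * d) with h | h
    · simp [h]
    · exact log_le_log (by exact_mod_cast h) (by linarith))
  have hB := hmul (fun i => log ((n i * d : ℕ) + 1)) (by
    filter_upwards [hle] with i hi
    exact ⟨log_nonneg (by
      have : (0 : ℝ) ≤ (n i * d : ℕ) := Nat.cast_nonneg _
      linarith), hi⟩)
  have := ((hinv.const_mul c).sub (hA.const_mul a)).sub (hB.const_mul b)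
  simp only [mul_zero, sub_zero] at this
  refine this.congr fun i => ?_
  rw [sub_div, sub_div, mul_div_assoc, mul_div_assoc, div_eq_mul_inv c]

/-- The law of a typical process on an edge has nonnegative growth rate, since it is a limit of
distributions whose growth rates are at least `-o(1)`. -/
theorem IsTypical.bethe_nonneg [DecidableEq S] (hd : 2 ≤ d) (hT : T.IsTree)
    (hreg : T.IsRegularOfDegree d) (hν : IsTypical d T ν) {u v : V} (huv : T.Adj u v) :
    0 ≤ bethe d fun k : S × S => ν.real {ω | ω u = k.1 ∧ ω v = k.2} := by
  classical
  obtain ⟨hinv, n, hn, hae⟩ := hν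
  have := hinv.isProbabilityMeasure
  have hd0 : 0 < d := by omega
  set p : S × S → ℝ := fun k => ν.real {ω | ω u = k.1 ∧ ω v = k.2} with hp
  have hprob : ∀ i, IsProbabilityMeasure (randomRegularGraph d (n i)) :=
    fun i => isProbabilityMeasure_randomRegularGraph (hn i)
  have hprobP : IsProbabilityMeasure (randomRegularSeq d n hn) := by
    rw [randomRegularSeq]; infer_instance
  have hntop : Tendsto n atTop atTop := by
    obtain ⟨G, hG, -, hgirth, f, hf⟩ := ((ae_mem_regularGraphs hn).and hae).exists
    exact hgirth.tendsto_card hd hG (hf.eventually_pos hd0 hT hreg hinv hG huv)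
  let R : ∀ i, Finset (SimpleGraph (Fin (n i))) := fun i =>
    (regularGraphs d (n i)).toFinite.toFinset
  have key : ∀ ε > 0, ∃ q : S × S → ℝ, dist q p < ε ∧ -ε ≤ bethe d q := by
    intro ε hε
    -- the statistics close to `p`, and the graphs that have a coloring with such statistics
    let 𝓜 : ℕ → Set (S × S → ℕ) := fun i =>
      {M | dist (fun k => (M k : ℝ) / (n i * d : ℕ)) p < ε}
    let E : ∀ i, Finset (SimpleGraph (Fin (n i))) := fun i =>
      (R i).filter fun G => ∃ f, dartType f G ∈ 𝓜 i
    obtain ⟨c, hc, N, hN⟩ := exists_mul_card_le hn E R (fun i => by simp [R])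
      (fun i => Finset.filter_subset _ _) (by
        filter_upwards [ae_mem_regularGraphs hn, hae] with G hG hlim
        obtain ⟨-, -, f, hf⟩ := hlim
        have h1 := tendsto_pi_nhds.2 fun k => hf.tendsto_dartType_div hd0 hT hreg hinv hG huv k
        obtain ⟨N, hN⟩ := eventually_atTop.1 (h1.eventually (Metric.ball_mem_nhds p hε))
        exact ⟨N, fun i hi => Finset.mem_filter.2 ⟨by simpa [R] using hG i, f i, hN i hi⟩⟩)
    have herr := tendsto_error_div hntop d (32 * d ^ 2 + Fintype.card S) (Fintype.card S ^ 2)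
      (log c - log 2 - Fintype.card S)
    obtain ⟨i, hi1, hi2, hi3⟩ := ((herr.eventually (lt_mem_nhds (neg_lt_zero.2 hε))).and
      ((eventually_ge_atTop N).and
        (hntop.eventually_ge_atTop (4 * d * (d + 1) + 16 * d ^ 2 + 6)))).exists
    have hni : 0 < n i := by omega
    obtain ⟨M, hM, hle⟩ := exists_le_mul_bethe hni hd0
      (hi3.trans (Nat.le_mul_of_pos_right _ hd0)) (𝓜 i) (E i) (R i) (fun G => by simp [R])
      ((hn i).imp fun G hG => by simpa [R] using hG) (Finset.filter_subset _ _) hc (hN i hi2)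
      (fun G hG => (Finset.mem_filter.1 hG).2)
    refine ⟨_, hM, ?_⟩
    have hnR : (0 : ℝ) < n i := by exact_mod_cast hni
    refine hi1.le.trans ?_
    rw [div_le_iff₀ hnR, mul_comm (bethe _ _)]
    refine le_trans (le_of_eq ?_) hle
    ring
  choose q hq1 hq2 using fun j : ℕ => key (1 / ((j : ℝ) + 1)) (by positivity)
  have hzero := tendsto_one_div_add_atTop_nhds_zero_nat (𝕜 := ℝ)
  have hqp : Tendsto q atTop (𝓝 p) := by
    rw [tendsto_iff_dist_tendsto_zero]
    exact squeeze_zero (fun _ => dist_nonneg) (fun j => (hq1 j).le) hzero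
  have hlim := ((continuous_bethe d).tendsto p).comp hqp
  have hneg := hzero.neg
  rw [neg_zero] at hneg
  exact le_of_tendsto_of_tendsto' hneg hlim hq2

end Main

end TypicalProcess

theorem theorem4p1 {V S : Type*} [DecidableEq V] [Fintype S] [MeasurableSpace S]
    [DiscreteMeasurableSpace S] (d : ℕ) (hd : 2 ≤ d)
    (T : SimpleGraph V) [T.LocallyFinite] (hT : T.IsTree) (hreg : T.IsRegularOfDegree d)
    (ν : Measure (V → S)) (hν : TypicalProcess.IsTypical d T ν)
    (u v w : V) (huv : T.Adj u v) :
    (d : ℝ) / 2 * TypicalProcess.configEntropy ν {u, v} ≥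
      ((d : ℝ) - 1) * TypicalProcess.configEntropy ν {w} := by
  classical
  have h := hν.bethe_nonneg hd hT hreg huv
  obtain ⟨hinv, n, hn, hae⟩ := hν
  have := hinv.isProbabilityMeasure
  have hprob : ∀ i, IsProbabilityMeasure (TypicalProcess.randomRegularGraph d (n i)) :=
    fun i => TypicalProcess.isProbabilityMeasure_randomRegularGraph (hn i)
  have hprobP : IsProbabilityMeasure (TypicalProcess.randomRegularSeq d n hn) := by
    rw [TypicalProcess.randomRegularSeq]; infer_instance
  obtain ⟨G, hG, -, -, f, hf⟩ := ((TypicalProcess.ae_mem_regularGraphs hn).and hae).exists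
  rw [TypicalProcess.bethe] at h
  simp only [TypicalProcess.sum_measureReal_edge,
    hf.measureReal_vertex_eq (by omega) hreg hG u w] at h
  rw [TypicalProcess.configEntropy_pair ν huv.ne, TypicalProcess.configEntropy_singleton]
  linarith
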